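/- Let $1\le r\le\infty$, $0\le s\le r$, $k,l\ge 0$. Let $W$ be a foliated manifold of class $C^{r,s}$ with $k$-dimensional leaves and transverse dimension $l$ (changes of charts are locally of the form $(x,y)\mapsto (X(x,y),Y(y))$ with $x\in\mathbb R^k$, $y\in\mathbb R^l$, $Y$ of class $C^s$ and $X$ of class $C^{r,s}$, where a map is of class $C^{r,s}$ if its partial derivatives $\partial_x^\alpha\partial_y^\beta$ with $|\alpha|+|\beta|\le r$, $|\beta|\le s$ exist and are continuous). Let $S\subset W$ be a compact union of leaves (a $k$-solenoid of class $C^{r,s}$) whose transversals are Cantor sets: every point of $S$ lies in a flow-box of $S$ of the form $D\times K$ with $D\subset\mathbb R^k$ an open ball and $K\subset\mathbb R^l$ homeomorphic to the Cantor set. Let $M$ be a $C^\infty$ manifold and let $f:S\to M$ be an immersion of the solenoid, that is, $f$ extends to a map of class $C^{r,s}$ on a neighbourhood of $S$ in $W$ and the differential of $f$ along the leaves is injective at every point of $S$. Let $N\subset M$ be a smooth embedded submanifold that is closed in $M$. Then there are an immersion $f_1:S\to M$ of the solenoid and a homotopy $H:S\times[0,1]\to M$ from $f$ to $f_1$, of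 class $C^{r,s}$ for the solenoid structure on $S\times[0,1]$ with leaves $\ell\times[0,1]$ ($\ell$ a leaf of $S$) and such that every $H(\cdot,t)$ is an immersion of $S$, such that $f_1$ intersects $N$ transversally: for every $p\in S$ with $f_1(p)\in N$, $$df_1(T_pS)+T_{f_1(p)}N=T_{f_1(p)}M,$$ where $T_pS$ is the tangent space at $p$ of the leaf through $p$. -/

import Mathlib

open Set Filter Topology Manifold
open scoped ContDiff

noncomputable section

/-- Maps of class `C^{r,s}` (with `s ≤ r`) on an open set `Ω` of `E × F`, where `E` is the leaf
direction and `F` is the transverse direction: all partial derivatives `∂ₓ^α ∂_y^β g` with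
`|α| + |β| ≤ r` and `|β| ≤ s` exist and are continuous on `Ω`.  Equivalently, `g` is leafwise of
class `C^r` and, for each `j ≤ r`, the `j`-th leafwise derivative is of class `C^{min (s, r - j)}`
in all the variables. -/
def ContDiffLeafOn {E F G : Type*} [NormedAddCommGroup E] [NormedSpace ℝ E]
    [NormedAddCommGroup F] [NormedSpace ℝ F] [NormedAddCommGroup G] [NormedSpace ℝ G]
    (r s : ℕ∞) (g : E × F → G) (Ω : Set (E × F)) : Prop :=
  (∀ z ∈ Ω, ContDiffAt ℝ r (fun x => g (x, z.2)) z.1) ∧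
  ∀ j : ℕ, (j : ℕ∞) ≤ r →
    ContDiffOn ℝ ((min s (r - (j : ℕ∞)) : ℕ∞) : WithTop ℕ∞)
      (fun z : E × F => iteratedFDeriv ℝ j (fun x => g (x, z.2)) z.1) Ω

section Foliated

variable (E F : Type*) [NormedAddCommGroup E] [NormedSpace ℝ E]
  [NormedAddCommGroup F] [NormedSpace ℝ F]

/-- `W` is a foliated manifold of class `C^{r,s}`, with leaves modelled on `E` and transverse
space `F`: on the overlaps the changes of charts are locally of the form
`(x, y) ↦ (X (x, y), Y y)` with `X` of class `C^{r,s}` and `Y` of class `C^s`. -/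
def IsFoliatedManifold (r s : ℕ∞) (W : Type*) [TopologicalSpace W] [ChartedSpace (E × F) W] :
    Prop :=
  ∀ e ∈ atlas (E × F) W, ∀ e' ∈ atlas (E × F) W,
    ContDiffLeafOn r s (fun z => (e' (e.symm z)).1) (e.symm.trans e').source ∧
    ∀ z ∈ (e.symm.trans e').source, ∃ Y : F → F, ContDiffAt ℝ s Y z.2 ∧
      ∀ᶠ w in 𝓝 z, (e' (e.symm w)).2 = Y w.2

variable {W : Type*} [TopologicalSpace W] [ChartedSpace (E × F) W]

/-- `q` lies in the plaque through `p` of some chart of the foliated atlas. -/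
def SamePlaque (p q : W) : Prop :=
  ∃ e ∈ atlas (E × F) W, p ∈ e.source ∧ q ∈ e.source ∧
    JoinedIn {z | z ∈ e.target ∧ z.2 = (e p).2} (e p) (e q)

/-- The leaf through `p`: the points that can be reached from `p` by a finite chain of plaques. -/
def leaf (p : W) : Set W := {q | Relation.ReflTransGen (SamePlaque E F) p q}

/-- `(S, W)` is a pre-solenoid: a compact subset of `W` that is a union of leaves. -/
def IsPreSolenoid (S : Set W) : Prop :=
  IsCompact S ∧ ∀ p ∈ S, leaf E F p ⊆ S

/-- The transversals of `S` are Cantor sets: every point of `S` lies in a flow-box `V ∩ S` that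
a foliated chart identifies with `D × K`, where `D` is an open ball of `E` and `K` is a subset
of `F` homeomorphic to the Cantor set. -/
def HasCantorTransversals (S : Set W) : Prop :=
  ∀ p ∈ S, ∃ e ∈ atlas (E × F) W, ∃ V : Set W, IsOpen V ∧ p ∈ V ∧ V ⊆ e.source ∧
    ∃ ε > 0, ∃ K : Set F, Nonempty (K ≃ₜ cantorSet) ∧
      e '' (V ∩ S) = Metric.ball (e p).1 ε ×ˢ K

/-- The reordering `((x, y), t) ↦ ((x, t), y)`. -/
def swapTimeTransverse : (E × F) × ℝ ≃ₜ (E × ℝ) × F where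
  toFun z := ((z.1.1, z.2), z.1.2)
  invFun z := ((z.1.1, z.2), z.1.2)
  left_inv _ := rfl
  right_inv _ := rfl
  continuous_toFun := by fun_prop
  continuous_invFun := by fun_prop

/-- `W × ℝ` foliated by the leaves `l × ℝ`, for `l` a leaf of `W`: a chart `p ↦ (x, y)` of `W`
gives the chart `(p, t) ↦ ((x, t), y)`. -/
instance foliatedProdReal : ChartedSpace ((E × ℝ) × F) (W × ℝ) where
  atlas := (fun e : OpenPartialHomeomorph W (E × F) =>
    (e.prod (OpenPartialHomeomorph.refl ℝ)).transHomeomorph (swapTimeTransverse E F)) ''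
      atlas (E × F) W
  chartAt p := ((chartAt (E × F) p.1).prod (OpenPartialHomeomorph.refl ℝ)).transHomeomorph
    (swapTimeTransverse E F)
  mem_chart_source p := by simp
  chart_mem_atlas p := ⟨_, chart_mem_atlas (E × F) p.1, rfl⟩

variable (n : ℕ) {M : Type*} [TopologicalSpace M] [ChartedSpace (EuclideanSpace ℝ (Fin n)) M]

/-- `f` is a map of class `C^{r,s}` from the open set `U` of the foliated manifold `W` to the
manifold `M`. -/
def IsLeafRegularOn (r s : ℕ∞) (f : W → M) (U : Set W) : Prop :=
  IsOpen U ∧ ContinuousOn f U ∧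
  ∀ e ∈ atlas (E × F) W, ∀ e' ∈ atlas (EuclideanSpace ℝ (Fin n)) M,
    ContDiffLeafOn r s (fun z => e' (f (e.symm z)))
      (e.target ∩ e.symm ⁻¹' (U ∩ f ⁻¹' e'.source))

/-- `f : S → M` is a regular map of class `C^{r,s}`: it extends to a map of class `C^{r,s}` on a
neighbourhood of `S` in `W`.  Only the values of `f` on `S` matter. -/
def IsSolenoidRegular (r s : ℕ∞) (f : W → M) (S : Set W) : Prop :=
  ∃ (U : Set W) (g : W → M), S ⊆ U ∧ EqOn g f S ∧ IsLeafRegularOn E F n r s g U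

/-- The differential of `f` at `p` along the leaf through `p`, where the tangent space of the leaf
is identified with `E` by the preferred chart at `p`.  For `p` in a pre-solenoid `S` it involves
only the values of `f` on `S`. -/
def leafDeriv (f : W → M) (p : W) : E →L[ℝ] TangentSpace (𝓡 n) (f p) :=
  mfderiv 𝓘(ℝ, E) (𝓡 n)
    (fun x : E => f ((chartAt (E × F) p).symm (x, (chartAt (E × F) p p).2)))
    (chartAt (E × F) p p).1

/-- `f : S → M` is an immersion of the solenoid `S`. -/
def IsSolenoidImmersion (r s : ℕ∞) (f : W → M) (S : Set W) : Prop :=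
  IsSolenoidRegular E F n r s f S ∧ ∀ p ∈ S, Function.Injective (leafDeriv E F n f p)

/-- `f : S → M` intersects transversally the embedded submanifold `ι : N → M`: the sum of the
image of the tangent space of the leaf and of the tangent space of `N` is the whole tangent space
of `M` whenever `f p = ι z`. -/
def IntersectsTransversally (d : ℕ) {N : Type*} [TopologicalSpace N]
    [ChartedSpace (EuclideanSpace ℝ (Fin d)) N] (f : W → M) (S : Set W) (ι : N → M) : Prop :=
  ∀ p ∈ S, ∀ z : N, f p = ι z →
    LinearMap.range (leafDeriv E F n f p).toLinearMap ⊔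
      (LinearMap.range (mfderiv (𝓡 d) (𝓡 n) ι z).toLinearMap :
        Submodule ℝ (EuclideanSpace ℝ (Fin n))) = ⊤

/-- `H : S × [0, 1] → M` is a homotopy of solenoid immersions from `f₀` to `f₁`: it is a regular
map of class `C^{r,s}` on the solenoid `S × [0, 1]`, whose leaves are `l × [0, 1]`, and each stage
`H (·, t)` is an immersion of `S`. -/
structure IsSolenoidHomotopy (r s : ℕ∞) (H : W × ℝ → M) (f₀ f₁ : W → M) (S : Set W) : Prop where
  regular : IsSolenoidRegular (E × ℝ) F n r s H (S ×ˢ Icc (0 : ℝ) 1)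
  immersion : ∀ t ∈ Icc (0 : ℝ) 1, IsSolenoidImmersion E F n r s (fun p => H (p, t)) S
  zero : ∀ p ∈ S, H (p, 0) = f₀ p
  one : ∀ p ∈ S, H (p, 1) = f₁ p

end Foliated

end

/-! In a chart of `M` adapted to `N`, the submanifold is the zero set of a linear submersion `π`.
Transversality of a leafwise map `u` then says that at each point either `π (u x) ≠ 0` or `π ∘ du`
is onto. This is an open condition on the leafwise 1-jet, as is being an immersion. Two facts make
it attainable.

On a single plaque, any `C^1` map can be approximated in `C^1`, over a compact ball, by a smooth map
satisfying the condition (`exists_regular_approx_on_compact`). One mollifies, then adds a small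
affine map. The bad affine maps lie in finitely many `C^1` images of spaces of dimension one less
than the parameter space, so a dimension count replaces Sard's theorem. Mollifying first is what
allows `r = 1`.

Across plaques, the transversal is a Cantor set. A smooth map chosen for the plaque `y` stays close
to the given map on all plaques near `y`. Since the transversal splits into small clopen pieces, the
choice can be made locally constant in `y` (`HasSeparatedNhds.exists_locally_constant_choice`). A
locally constant family is regular in the transverse direction for every `s`, and no genericity in
families is needed.

Inside a flow-box the homotopy `H` is replaced, in the chart `Θ`, by `Θ H + t φ (c - Θ H₁)`, where
`φ` is a leafwise cut-off and `c` is the locally constant family (`IsAdmissibleHomotopy.step`).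
Where `φ = 1` the final map is exactly `c`. Elsewhere the leafwise 1-jet moves little, so
immersivity and the transversality already achieved survive. Finitely many boxes cover `S`. An open
set containing the graph of `f`, fixed in advance, keeps every intermediate map inside the charts
needed by the later steps. -/

noncomputable section

/-! ### Calculus of maps of class `C^{r,s}` -/

section LeafCalculus

variable {E E' F G G' : Type*} [NormedAddCommGroup E] [NormedSpace ℝ E]
  [NormedAddCommGroup E'] [NormedSpace ℝ E'] [NormedAddCommGroup F] [NormedSpace ℝ F]
  [NormedAddCommGroup G] [NormedSpace ℝ G] [NormedAddCommGroup G'] [NormedSpace ℝ G']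
  {r s : ℕ∞}

/-- `g` is of class `C^{r,s}` on a neighbourhood of `z`. -/
def ContDiffLeafAt (r s : ℕ∞) (g : E × F → G) (z : E × F) : Prop :=
  ∃ Ω, IsOpen Ω ∧ z ∈ Ω ∧ ContDiffLeafOn r s g Ω

theorem ContDiffLeafOn.mono {g : E × F → G} {Ω Ω' : Set (E × F)} (h : ContDiffLeafOn r s g Ω)
    (hs : Ω' ⊆ Ω) : ContDiffLeafOn r s g Ω' :=
  ⟨fun z hz => h.1 z (hs hz), fun j hj => (h.2 j hj).mono hs⟩

theorem contDiffLeafOn_of_at {g : E × F → G} {Ω : Set (E × F)}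
    (h : ∀ z ∈ Ω, ContDiffLeafAt r s g z) : ContDiffLeafOn r s g Ω := by
  refine ⟨fun z hz => ?_, fun j hj z hz => ?_⟩
  · obtain ⟨U, -, hzU, hU⟩ := h z hz
    exact hU.1 z hzU
  · obtain ⟨U, hUo, hzU, hU⟩ := h z hz
    exact ((hU.2 j hj).contDiffAt (hUo.mem_nhds hzU)).contDiffWithinAt

theorem ContDiffLeafOn.at {g : E × F → G} {Ω : Set (E × F)} (h : ContDiffLeafOn r s g Ω)
    {z : E × F} (hz : Ω ∈ 𝓝 z) : ContDiffLeafAt r s g z := by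
  obtain ⟨U, hU, hUo, hzU⟩ := mem_nhds_iff.1 hz
  exact ⟨U, hUo, hzU, h.mono hU⟩

theorem ContDiffLeafAt.eventually {g : E × F → G} {z : E × F} (h : ContDiffLeafAt r s g z) :
    ∀ᶠ w in 𝓝 z, ContDiffLeafAt r s g w := by
  obtain ⟨U, hUo, hzU, hU⟩ := h
  filter_upwards [hUo.mem_nhds hzU] with w hw
  exact ⟨U, hUo, hw, hU⟩

omit [NormedSpace ℝ E] [NormedSpace ℝ F] [NormedAddCommGroup G] [NormedSpace ℝ G] in
theorem slice_eventuallyEq {g g' : E × F → G} {z : E × F} (hg : g =ᶠ[𝓝 z] g') :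
    (fun x => g (x, z.2)) =ᶠ[𝓝 z.1] fun x => g' (x, z.2) := by
  have : Tendsto (fun x : E => (x, z.2)) (𝓝 z.1) (𝓝 z) := by
    have : ContinuousAt (fun x : E => (x, z.2)) z.1 := by fun_prop
    exact this
  exact this.eventually hg

theorem ContDiffLeafAt.congr {g g' : E × F → G} {z : E × F} (h : ContDiffLeafAt r s g z)
    (hg : g' =ᶠ[𝓝 z] g) : ContDiffLeafAt r s g' z := by
  obtain ⟨U, hUo, hzU, hU⟩ := h
  obtain ⟨V, hV, hVo, hzV⟩ := eventually_nhds_iff.1 hg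
  have key : ∀ w ∈ U ∩ V, (fun x => g' (x, w.2)) =ᶠ[𝓝 w.1] fun x => g (x, w.2) := fun w hw =>
    slice_eventuallyEq (eventually_of_mem (hVo.mem_nhds hw.2) hV)
  refine ⟨U ∩ V, hUo.inter hVo, ⟨hzU, hzV⟩, fun w hw => (hU.1 w hw.1).congr_of_eventuallyEq
    (key w hw), fun j hj => ((hU.2 j hj).mono inter_subset_left).congr fun w hw => ?_⟩
  exact (Filter.EventuallyEq.iteratedFDeriv (𝕜 := ℝ) (key w hw) j).eq_of_nhds

theorem ContDiffLeafAt.contDiffAt_slice {g : E × F → G} {z : E × F}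
    (h : ContDiffLeafAt r s g z) : ContDiffAt ℝ r (fun x => g (x, z.2)) z.1 := by
  obtain ⟨U, -, hzU, hU⟩ := h
  exact hU.1 z hzU

theorem ContDiffLeafAt.continuousAt {g : E × F → G} {z : E × F}
    (h : ContDiffLeafAt r s g z) : ContinuousAt g z := by
  obtain ⟨U, hUo, hzU, hU⟩ := h
  have h0 := ((hU.2 0 (by simp)).contDiffAt (hUo.mem_nhds hzU)).continuousAt
  have := (continuousMultilinearCurryFin0 ℝ E G).continuous.continuousAt.comp h0
  refine this.congr (Eventually.of_forall fun w => ?_)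
  simp [iteratedFDeriv_zero_eq_comp]

theorem ContDiffLeafAt.continuousAt_fderiv {g : E × F → G} {z : E × F} (hr : 1 ≤ r)
    (h : ContDiffLeafAt r s g z) :
    ContinuousAt (fun z : E × F => fderiv ℝ (fun x => g (x, z.2)) z.1) z := by
  obtain ⟨U, hUo, hzU, hU⟩ := h
  have h1 := ((hU.2 1 (by simpa using hr)).contDiffAt (hUo.mem_nhds hzU)).continuousAt
  have := (continuousMultilinearCurryFin1 ℝ E G).continuous.continuousAt.comp h1
  refine this.congr (Eventually.of_forall fun w => ?_)
  ext v
  simp [continuousMultilinearCurryFin1_apply, iteratedFDeriv_one_apply]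

theorem ContDiffLeafAt.of_fst {φ : E → G} {z : E × F} (h : ∀ᶠ x in 𝓝 z.1, ContDiffAt ℝ ∞ φ x) :
    ContDiffLeafAt r s (fun w : E × F => φ w.1) z := by
  obtain ⟨V, hV, hVo, hzV⟩ := eventually_nhds_iff.1 h
  refine ⟨V ×ˢ univ, hVo.prod isOpen_univ, ⟨hzV, trivial⟩, fun w hw => ?_, fun j hj w hw => ?_⟩
  · exact (hV _ hw.1).of_le (by exact_mod_cast le_top)
  · have : ContDiffAt ℝ ∞ (iteratedFDeriv ℝ j φ) w.1 :=
      (hV _ hw.1).iteratedFDeriv_right (by exact_mod_cast le_top)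
    exact ((this.comp w contDiffAt_fst).of_le (by exact_mod_cast le_top)).contDiffWithinAt

theorem ContDiffLeafAt.prodMk {g : E × F → G} {g' : E × F → G'} {z : E × F}
    (h : ContDiffLeafAt r s g z) (h' : ContDiffLeafAt r s g' z) :
    ContDiffLeafAt r s (fun w => (g w, g' w)) z := by
  obtain ⟨U, hUo, hzU, hU⟩ := h
  obtain ⟨V, hVo, hzV, hV⟩ := h'
  refine ⟨U ∩ V, hUo.inter hVo, ⟨hzU, hzV⟩, fun w hw => (hU.1 w hw.1).prodMk (hV.1 w hw.2),
    fun j hj => ?_⟩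
  have h1 := (hU.2 j hj).mono (inter_subset_left (t := V))
  have h2 := (hV.2 j hj).mono (inter_subset_right (s := U))
  have h3 := (ContinuousMultilinearMap.prodL ℝ (fun _ : Fin j => E) G G').contDiff.comp_contDiffOn
    (h1.prodMk h2)
  refine h3.congr fun w hw => ?_
  exact iteratedFDeriv_prodMk (hU.1 w hw.1) (hV.1 w hw.2) (by exact_mod_cast hj)

/-- By the Faà di Bruno formula, the `j`-th leafwise derivative of `Φ ∘ u` is a finite sum of
multilinear expressions in derivatives of `Φ` at `u` and in leafwise derivatives of `u` of order at
most `j`. Each factor has class at least `min s (r - j)`. -/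
theorem ContDiffLeafAt.comp_left {u : E × F → G} {Φ : G → G'} {z : E × F} {V : Set G}
    (hV : IsOpen V) (hΦ : ContDiffOn ℝ ∞ Φ V) (hu : ContDiffLeafAt r s u z) (hz : u z ∈ V) :
    ContDiffLeafAt r s (fun w => Φ (u w)) z := by
  have hcont := hu.continuousAt
  obtain ⟨U, hUo, hzU, hU⟩ := hu
  obtain ⟨U', hU'V, hU'o, hzU'⟩ := eventually_nhds_iff.1 (hcont.eventually (hV.mem_nhds hz))
  have hΦ' : ∀ w ∈ U', ContDiffAt ℝ ∞ Φ (u w) := fun w hw => hΦ.contDiffAt (hV.mem_nhds (hU'V w hw))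
  have hsl : ∀ w ∈ U ∩ U', ContDiffAt ℝ r (fun x => Φ (u (x, w.2))) w.1 := fun w hw =>
    ((hΦ' w hw.2).of_le (by exact_mod_cast le_top)).comp w.1 (hU.1 w hw.1)
  refine ⟨U ∩ U', hUo.inter hU'o, ⟨hzU, hzU'⟩, hsl, fun j hj => ?_⟩
  have hu0 : ContDiffOn ℝ ((min s (r - (j : ℕ∞)) : ℕ∞) : WithTop ℕ∞) u (U ∩ U') := by
    have h0 := (hU.2 0 (by simp)).mono (inter_subset_left (t := U'))
    have h1 := (continuousMultilinearCurryFin0 ℝ E G).contDiff.comp_contDiffOn h0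
    refine (h1.of_le ?_).congr fun w hw => ?_
    · exact_mod_cast min_le_min le_rfl (tsub_le_tsub_left (by simp) r)
    · simp [iteratedFDeriv_zero_eq_comp]
  have heq : ∀ w ∈ U ∩ U', iteratedFDeriv ℝ j (fun x => Φ (u (x, w.2))) w.1 =
      ∑ c : OrderedFinpartition j, c.compAlongOrderedFinpartitionL ℝ E G G'
        (iteratedFDeriv ℝ c.length Φ (u w))
        (fun i => iteratedFDeriv ℝ (c.partSize i) (fun x => u (x, w.2)) w.1) := fun w hw => by
    have := iteratedFDeriv_comp (g := Φ) (f := fun x => u (x, w.2)) (x := w.1) (n := r)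
      ((hΦ' w hw.2).of_le (by exact_mod_cast le_top)) (hU.1 w hw.1) (i := j) (by exact_mod_cast hj)
    exact this
  refine ContDiffOn.congr (ContDiffOn.sum fun c _ => ?_) heq
  have hA : ContDiffOn ℝ ((min s (r - (j : ℕ∞)) : ℕ∞) : WithTop ℕ∞)
      (fun w => iteratedFDeriv ℝ c.length Φ (u w)) (U ∩ U') := fun w hw => by
    have h1 : ContDiffAt ℝ ∞ (iteratedFDeriv ℝ c.length Φ) (u w) :=
      (hΦ' w hw.2).iteratedFDeriv_right (by exact_mod_cast le_top)
    exact (h1.of_le (by exact_mod_cast le_top)).comp_contDiffWithinAt w (hu0 w hw)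
  have hB : ContDiffOn ℝ ((min s (r - (j : ℕ∞)) : ℕ∞) : WithTop ℕ∞)
      (fun w : E × F => fun i : Fin c.length =>
        iteratedFDeriv ℝ (c.partSize i) (fun x => u (x, w.2)) w.1) (U ∩ U') := by
    refine contDiffOn_pi.2 fun i => ?_
    have hle : ((c.partSize i : ℕ) : ℕ∞) ≤ j := by exact_mod_cast c.partSize_le i
    refine ((hU.2 _ (hle.trans hj)).mono inter_subset_left).of_le ?_
    exact_mod_cast min_le_min le_rfl (tsub_le_tsub_left hle r)
  have hC : ContDiffOn ℝ ((min s (r - (j : ℕ∞)) : ℕ∞) : WithTop ℕ∞) (fun w : E × F =>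
      (c.compAlongOrderedFinpartitionL ℝ E G G').flipMultilinear (fun i : Fin c.length =>
        iteratedFDeriv ℝ (c.partSize i) (fun x => u (x, w.2)) w.1)) (U ∩ U') := by
    have := ContinuousMultilinearMap.contDiff
      (E := fun i : Fin c.length => E [×c.partSize i]→L[ℝ] G)
      (F := (G [×c.length]→L[ℝ] G') →L[ℝ] E [×j]→L[ℝ] G') (𝕜 := ℝ)
      ((c.compAlongOrderedFinpartitionL ℝ E G G').flipMultilinear)
      (n := ((min s (r - (j : ℕ∞)) : ℕ∞) : WithTop ℕ∞))
    exact this.comp_contDiffOn hB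
  exact hC.clm_apply hA

/-- An affine change of the leaf variable only pulls the multilinear derivatives back by `L`. Taking
`L` to be the inclusion of `E` in `E × ℝ` freezes time, and taking it to be the projection adds a
time variable. -/
theorem ContDiffLeafAt.comp_affine {g : E × F → G} (L : E' →L[ℝ] E) (a : E) {z : E' × F}
    (hg : ContDiffLeafAt r s g (L z.1 + a, z.2)) :
    ContDiffLeafAt r s (fun w : E' × F => g (L w.1 + a, w.2)) z := by
  obtain ⟨U, hUo, hzU, hU⟩ := hg
  have hcd : ContDiff ℝ ∞ fun w : E' × F => (L w.1 + a, w.2) := by fun_prop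
  refine ⟨(fun w : E' × F => (L w.1 + a, w.2)) ⁻¹' U, hUo.preimage hcd.continuous, hzU,
    fun w hw => ?_, fun j hj => ?_⟩
  · have h1 := hU.1 _ hw
    exact ContDiffAt.comp (g := fun x => g (x, w.2)) (f := fun x => L x + a) w.1 h1 (by fun_prop)
  · have h1 : ContDiffOn ℝ ((min s (r - (j : ℕ∞)) : ℕ∞) : WithTop ℕ∞)
        (fun w : E' × F => iteratedFDeriv ℝ j (fun x => g (x, w.2)) (L w.1 + a))
        ((fun w : E' × F => (L w.1 + a, w.2)) ⁻¹' U) :=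
      (hU.2 j hj).comp ((hcd.of_le (by exact_mod_cast le_top)).contDiffOn) (mapsTo_preimage _ _)
    have h2 := (ContinuousMultilinearMap.compContinuousLinearMapL (𝕜 := ℝ) (F := G)
      (fun _ : Fin j => L)).contDiff.comp_contDiffOn h1
    refine h2.congr fun w hw => ?_
    have hVo : IsOpen {x : E | (x + a, w.2) ∈ U} := hUo.preimage (by fun_prop)
    have h3 : ContDiffOn ℝ r (fun x => g (x + a, w.2)) {x : E | (x + a, w.2) ∈ U} := fun x hx =>
      (ContDiffAt.comp (g := fun x => g (x, w.2)) (f := fun x => x + a) x (hU.1 _ hx)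
        (by fun_prop)).contDiffWithinAt
    have h4 := L.iteratedFDerivWithin_comp_right h3 hVo.uniqueDiffOn
      (hVo.preimage L.continuous).uniqueDiffOn hw (i := j) (by exact_mod_cast hj)
    rw [iteratedFDerivWithin_of_isOpen j (hVo.preimage L.continuous) hw,
      iteratedFDerivWithin_of_isOpen j hVo hw,
      iteratedFDeriv_comp_add_right (f := fun x => g (x, w.2)) j a] at h4
    exact h4

end LeafCalculus

/-! ### Regularity and leafwise differentials in arbitrary charts -/

section LeafRegular

variable (E F : Type*) [NormedAddCommGroup E] [NormedSpace ℝ E]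
  [NormedAddCommGroup F] [NormedSpace ℝ F]
  {W : Type*} [TopologicalSpace W] [ChartedSpace (E × F) W]
  (n : ℕ) {M : Type*} [TopologicalSpace M] [ChartedSpace (EuclideanSpace ℝ (Fin n)) M]

/-- `f` is of class `C^{r,s}` at `p`, in all charts. -/
def LeafRegularAt (r s : ℕ∞) (f : W → M) (p : W) : Prop :=
  ContinuousAt f p ∧ ∀ e ∈ atlas (E × F) W, p ∈ e.source →
    ∀ e' ∈ atlas (EuclideanSpace ℝ (Fin n)) M, f p ∈ e'.source →
      ContDiffLeafAt r s (fun z => e' (f (e.symm z))) (e p)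

variable {E F n} {r s : ℕ∞}

omit [NormedSpace ℝ E] [NormedSpace ℝ F] [ChartedSpace (E × F) W] in
theorem eventually_symm {e : OpenPartialHomeomorph W (E × F)} {p : W} (hp : p ∈ e.source)
    {P : W → Prop} (h : ∀ᶠ q in 𝓝 p, P q) : ∀ᶠ z in 𝓝 (e p), P (e.symm z) := by
  have := e.continuousAt_symm (e.map_source hp)
  rw [ContinuousAt, e.left_inv hp] at this
  exact this.eventually h

theorem isLeafRegularOn_iff {f : W → M} {U : Set W} :
    IsLeafRegularOn E F n r s f U ↔ IsOpen U ∧ ∀ p ∈ U, LeafRegularAt E F n r s f p := by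
  refine ⟨fun ⟨hU, hc, h⟩ => ⟨hU, fun p hp => ⟨hc.continuousAt (hU.mem_nhds hp),
    fun e he hpe e' he' hpe' => (h e he e' he').at ?_⟩⟩, fun ⟨hU, h⟩ => ⟨hU, fun p hp =>
      (h p hp).1.continuousWithinAt, fun e he e' he' => contDiffLeafOn_of_at fun z hz => ?_⟩⟩
  · refine (eventually_mem_set.2 (e.open_target.mem_nhds (e.map_source hpe))).and
      (eventually_symm hpe (P := fun q => q ∈ U ∩ f ⁻¹' e'.source) ?_)
    exact inter_mem (hU.mem_nhds hp)
      ((hc.continuousAt (hU.mem_nhds hp)).preimage_mem_nhds (e'.open_source.mem_nhds hpe'))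
  · have := (h _ hz.2.1).2 e he (e.map_target hz.1) e' he' hz.2.2
    rwa [e.right_inv hz.1] at this

theorem LeafRegularAt.congr {f g : W → M} {p : W} (h : LeafRegularAt E F n r s f p)
    (hg : g =ᶠ[𝓝 p] f) : LeafRegularAt E F n r s g p := by
  refine ⟨h.1.congr hg.symm, fun e he hpe e' he' hpe' => ?_⟩
  rw [hg.eq_of_nhds] at hpe'
  refine (h.2 e he hpe e' he' hpe').congr ?_
  filter_upwards [eventually_symm hpe hg] with z hz using by rw [hz]

theorem contDiffOn_chart_transition [IsManifold (𝓡 n) ∞ M]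
    {Θ Θ' : OpenPartialHomeomorph M (EuclideanSpace ℝ (Fin n))}
    (hΘ : Θ ∈ IsManifold.maximalAtlas (𝓡 n) ∞ M) (hΘ' : Θ' ∈ IsManifold.maximalAtlas (𝓡 n) ∞ M) :
    ContDiffOn ℝ ∞ (fun m => Θ' (Θ.symm m)) (Θ.symm.trans Θ').source := by
  have h1 : ContMDiffOn (𝓡 n) (𝓡 n) ∞ (Θ' ∘ Θ.symm) (Θ.target ∩ Θ.symm ⁻¹' Θ'.source) :=
    (contMDiffOn_of_mem_maximalAtlas hΘ').comp' (contMDiffOn_symm_of_mem_maximalAtlas hΘ)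
  rw [contMDiffOn_iff_contDiffOn] at h1
  simpa [Function.comp_def] using h1

omit [ChartedSpace (E × F) W] in
theorem LeafRegularAt.change_chart [IsManifold (𝓡 n) ∞ M]
    {Θ Θ' : OpenPartialHomeomorph M (EuclideanSpace ℝ (Fin n))}
    (hΘ : Θ ∈ IsManifold.maximalAtlas (𝓡 n) ∞ M) (hΘ' : Θ' ∈ IsManifold.maximalAtlas (𝓡 n) ∞ M)
    {f : W → M} {p : W} (hf : ContinuousAt f p) (hp : f p ∈ Θ.source) (hp' : f p ∈ Θ'.source)
    {e : OpenPartialHomeomorph W (E × F)} (hpe : p ∈ e.source)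
    (h : ContDiffLeafAt r s (fun z => Θ (f (e.symm z))) (e p)) :
    ContDiffLeafAt r s (fun z => Θ' (f (e.symm z))) (e p) := by
  have := h.comp_left (Θ.symm.trans Θ').open_source (contDiffOn_chart_transition hΘ hΘ')
    (by simp [e.left_inv hpe, hp, hp'])
  refine this.congr ?_
  filter_upwards [eventually_symm hpe (hf.eventually (Θ.open_source.mem_nhds hp))] with z hz
  rw [Θ.left_inv hz]

theorem LeafRegularAt.chart [IsManifold (𝓡 n) ∞ M]
    {Θ : OpenPartialHomeomorph M (EuclideanSpace ℝ (Fin n))}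
    (hΘ : Θ ∈ IsManifold.maximalAtlas (𝓡 n) ∞ M) {f : W → M} {p : W}
    (h : LeafRegularAt E F n r s f p) (hp : f p ∈ Θ.source)
    {e : OpenPartialHomeomorph W (E × F)} (he : e ∈ atlas (E × F) W) (hpe : p ∈ e.source) :
    ContDiffLeafAt r s (fun z => Θ (f (e.symm z))) (e p) :=
  LeafRegularAt.change_chart (IsManifold.chart_mem_maximalAtlas (f p)) hΘ h.1
    (mem_chart_source _ _) hp hpe (h.2 e he hpe _ (chart_mem_atlas _ _) (mem_chart_source _ _))

theorem leafRegularAt_of_chart [IsManifold (𝓡 n) ∞ M]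
    {Θ : OpenPartialHomeomorph M (EuclideanSpace ℝ (Fin n))}
    (hΘ : Θ ∈ IsManifold.maximalAtlas (𝓡 n) ∞ M) {f : W → M} {p : W} (hf : ContinuousAt f p)
    (hp : f p ∈ Θ.source)
    (h : ∀ e ∈ atlas (E × F) W, p ∈ e.source →
      ContDiffLeafAt r s (fun z => Θ (f (e.symm z))) (e p)) : LeafRegularAt E F n r s f p :=
  ⟨hf, fun e he hpe _ he' hpe' => LeafRegularAt.change_chart hΘ
    (IsManifold.subset_maximalAtlas he') hf hp hpe' hpe (h e he hpe)⟩

/-- The chart of `W × ℝ` associated with a chart of `W`. -/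
def timeChart (e : OpenPartialHomeomorph W (E × F)) :
    OpenPartialHomeomorph (W × ℝ) ((E × ℝ) × F) :=
  (e.prod (OpenPartialHomeomorph.refl ℝ)).transHomeomorph (swapTimeTransverse E F)

omit [NormedSpace ℝ E] [NormedSpace ℝ F] [ChartedSpace (E × F) W] in
@[simp] theorem timeChart_source (e : OpenPartialHomeomorph W (E × F)) :
    (timeChart e).source = e.source ×ˢ univ := by simp [timeChart]

omit [NormedSpace ℝ E] [NormedSpace ℝ F] [ChartedSpace (E × F) W] in
@[simp] theorem timeChart_apply (e : OpenPartialHomeomorph W (E × F)) (p : W × ℝ) :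
    timeChart e p = (((e p.1).1, p.2), (e p.1).2) := rfl

omit [NormedSpace ℝ E] [NormedSpace ℝ F] [ChartedSpace (E × F) W] in
@[simp] theorem timeChart_symm_apply (e : OpenPartialHomeomorph W (E × F)) (z : (E × ℝ) × F) :
    (timeChart e).symm z = (e.symm (z.1.1, z.2), z.1.2) := rfl

omit [NormedSpace ℝ E] [NormedSpace ℝ F] in
theorem mem_atlas_time {ê : OpenPartialHomeomorph (W × ℝ) ((E × ℝ) × F)} :
    ê ∈ atlas ((E × ℝ) × F) (W × ℝ) ↔ ∃ e ∈ atlas (E × F) W, timeChart e = ê := Iff.rfl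

theorem LeafRegularAt.stage {H : W × ℝ → M} {p : W} {t : ℝ}
    (h : LeafRegularAt (E × ℝ) F n r s H (p, t)) :
    LeafRegularAt E F n r s (fun q => H (q, t)) p := by
  refine ⟨h.1.comp (f := fun q => (q, t)) (by fun_prop), fun e he hpe e' he' hpe' => ?_⟩
  have h1 := h.2 _ (mem_atlas_time.2 ⟨e, he, rfl⟩) (by simpa using hpe) e' he' hpe'
  have := ContDiffLeafAt.comp_affine (r := r) (s := s)
    (g := fun z => e' (H ((timeChart e).symm z))) (ContinuousLinearMap.inl ℝ E ℝ) (0, t)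
    (z := e p) (by simpa using h1)
  simpa using this

theorem LeafRegularAt.extend {f : W → M} {p : W} (t : ℝ) (h : LeafRegularAt E F n r s f p) :
    LeafRegularAt (E × ℝ) F n r s (fun q : W × ℝ => f q.1) (p, t) := by
  refine ⟨h.1.comp (f := Prod.fst) (x := (p, t)) (by fun_prop), fun ê hê hpe e' he' hpe' => ?_⟩
  obtain ⟨e, he, rfl⟩ := mem_atlas_time.1 hê
  have hpe : p ∈ e.source := by simpa using hpe
  have := ContDiffLeafAt.comp_affine (r := r) (s := s)
    (g := fun z => e' (f (e.symm z))) (ContinuousLinearMap.fst ℝ E ℝ) 0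
    (z := timeChart e (p, t)) (by simpa using h.2 e he hpe e' he' hpe')
  simpa using this

theorem contDiffLeafAt_transition_fst (hW : IsFoliatedManifold E F r s W)
    {e e' : OpenPartialHomeomorph W (E × F)} (he : e ∈ atlas (E × F) W)
    (he' : e' ∈ atlas (E × F) W) {p : W} (hpe : p ∈ e.source) (hpe' : p ∈ e'.source) :
    ContDiffLeafAt r s (fun z => (e' (e.symm z)).1) (e p) :=
  (hW e he e' he').1.at ((e.symm.trans e').open_source.mem_nhds (by simp [hpe, hpe']))

theorem eventually_transition_snd (hW : IsFoliatedManifold E F r s W)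
    {e e' : OpenPartialHomeomorph W (E × F)} (he : e ∈ atlas (E × F) W)
    (he' : e' ∈ atlas (E × F) W) {p : W} (hpe : p ∈ e.source) (hpe' : p ∈ e'.source) :
    ∀ᶠ x in 𝓝 (e p).1, (e' (e.symm (x, (e p).2))).2 = (e' p).2 := by
  obtain ⟨Y, -, hY⟩ := (hW e he e' he').2 (e p) (by simp [hpe, hpe'])
  have h := slice_eventuallyEq (g := fun w => (e' (e.symm w)).2) (g' := fun w => Y w.2) hY
  have h0 : (e' p).2 = Y (e p).2 := by simpa [e.left_inv hpe] using h.eq_of_nhds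
  filter_upwards [h] with x hx
  rw [h0]; exact hx

/-- The transverse coordinate of one chart is constant along the plaques of the other. The two
leafwise transition maps are therefore inverse to each other near `p`, and the chain rule makes
their derivatives inverse. -/
theorem exists_leaf_transition (hr : 1 ≤ r) (hW : IsFoliatedManifold E F r s W)
    {e e' : OpenPartialHomeomorph W (E × F)} (he : e ∈ atlas (E × F) W)
    (he' : e' ∈ atlas (E × F) W) {p : W} (hpe : p ∈ e.source) (hpe' : p ∈ e'.source) :
    ∃ A : E ≃L[ℝ] E, HasFDerivAt (fun x => (e' (e.symm (x, (e p).2))).1) (A : E →L[ℝ] E) (e p).1 := by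
  have hr' : (r : WithTop ℕ∞) ≠ 0 := by
    rintro h
    have : r = 0 := by exact_mod_cast h
    simp [this] at hr
  have main : ∀ {e e' : OpenPartialHomeomorph W (E × F)}, e ∈ atlas (E × F) W →
      e' ∈ atlas (E × F) W → p ∈ e.source → p ∈ e'.source →
      DifferentiableAt ℝ (fun x => (e' (e.symm (x, (e p).2))).1) (e p).1 ∧
      (fun x => (e (e'.symm ((e' (e.symm (x, (e p).2))).1, (e' p).2))).1) =ᶠ[𝓝 (e p).1] id := by
    intro e e' he he' hpe hpe'
    refine ⟨((contDiffLeafAt_transition_fst hW he he' hpe hpe').contDiffAt_slice).differentiableAt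
      hr', ?_⟩
    have hc : ContinuousAt (fun x => e.symm (x, (e p).2)) (e p).1 :=
      (e.continuousAt_symm (e.map_source hpe)).comp (f := fun x => (x, (e p).2)) (by fun_prop)
    have h1 : ∀ᶠ x in 𝓝 (e p).1, e.symm (x, (e p).2) ∈ e'.source :=
      hc (e'.open_source.mem_nhds (by simpa [e.left_inv hpe] using hpe'))
    have h2 : ∀ᶠ x in 𝓝 (e p).1, (x, (e p).2) ∈ e.target :=
      ContinuousAt.preimage_mem_nhds (f := fun x => (x, (e p).2)) (by fun_prop)
        (e.open_target.mem_nhds (e.map_source hpe))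
    filter_upwards [h1, h2, eventually_transition_snd hW he he' hpe hpe'] with x hx1 hx2 hx3
    rw [← hx3, Prod.mk.eta, e'.left_inv hx1, e.right_inv hx2, id]
  obtain ⟨d1, i1⟩ := main he he' hpe hpe'
  obtain ⟨d2, i2⟩ := main he' he hpe' hpe
  have hd1 := d1.hasFDerivAt
  have hd2 := d2.hasFDerivAt
  set A := fderiv ℝ (fun x => (e' (e.symm (x, (e p).2))).1) (e p).1
  set B := fderiv ℝ (fun x => (e (e'.symm (x, (e' p).2))).1) (e' p).1
  have hBA : B.comp A = ContinuousLinearMap.id ℝ E :=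
    ((HasFDerivAt.comp (g := fun x => (e (e'.symm (x, (e' p).2))).1) (e p).1
      (by simpa [e.left_inv hpe] using hd2) hd1).congr_of_eventuallyEq i1.symm).unique
      (hasFDerivAt_id _)
  have hAB : A.comp B = ContinuousLinearMap.id ℝ E :=
    ((HasFDerivAt.comp (g := fun x => (e' (e.symm (x, (e p).2))).1) (e' p).1
      (by simpa [e'.left_inv hpe'] using hd1) hd2).congr_of_eventuallyEq i2.symm).unique
      (hasFDerivAt_id _)
  exact ⟨ContinuousLinearEquiv.equivOfInverse A B (fun x => by simpa using congr($hBA x))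
    (fun x => by simpa using congr($hAB x)), hd1⟩

variable (n) in
/-- The derivative of a chart of `M`, between the model spaces. -/
def chartDeriv (Θ : OpenPartialHomeomorph M (EuclideanSpace ℝ (Fin n))) (m : M) :
    EuclideanSpace ℝ (Fin n) →L[ℝ] EuclideanSpace ℝ (Fin n) :=
  mfderiv (𝓡 n) (𝓡 n) Θ m

theorem mdifferentiable_of_mem_maximalAtlas [IsManifold (𝓡 n) ∞ M]
    {Θ : OpenPartialHomeomorph M (EuclideanSpace ℝ (Fin n))}
    (hΘ : Θ ∈ IsManifold.maximalAtlas (𝓡 n) ∞ M) : Θ.MDifferentiable (𝓡 n) (𝓡 n) :=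
  ⟨(contMDiffOn_of_mem_maximalAtlas hΘ).mdifferentiableOn (by simp),
    (contMDiffOn_symm_of_mem_maximalAtlas hΘ).mdifferentiableOn (by simp)⟩

theorem bijective_chartDeriv [IsManifold (𝓡 n) ∞ M]
    {Θ : OpenPartialHomeomorph M (EuclideanSpace ℝ (Fin n))}
    (hΘ : Θ ∈ IsManifold.maximalAtlas (𝓡 n) ∞ M) {m : M} (hm : m ∈ Θ.source) :
    Function.Bijective (chartDeriv n Θ m) :=
  (mdifferentiable_of_mem_maximalAtlas hΘ).mfderiv_bijective hm

theorem chartDeriv_comp_mfderiv [IsManifold (𝓡 n) ∞ M]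
    {Θ : OpenPartialHomeomorph M (EuclideanSpace ℝ (Fin n))}
    (hΘ : Θ ∈ IsManifold.maximalAtlas (𝓡 n) ∞ M) {γ : E → M} {x : E} (hγ : ContinuousAt γ x)
    {m : M} (hm : γ x = m) (hmΘ : m ∈ Θ.source)
    (hd : DifferentiableAt ℝ (fun y => Θ (γ y)) x) :
    (chartDeriv n Θ m).comp
      (show E →L[ℝ] EuclideanSpace ℝ (Fin n) from mfderiv 𝓘(ℝ, E) (𝓡 n) γ x) =
      fderiv ℝ (fun y => Θ (γ y)) x := by
  subst hm
  have hΘd := mdifferentiable_of_mem_maximalAtlas hΘ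
  have hγ' : MDifferentiableAt 𝓘(ℝ, E) (𝓡 n) γ x := by
    have h1 : MDifferentiableAt 𝓘(ℝ, E) (𝓡 n) (fun y => Θ.symm (Θ (γ y))) x :=
      MDifferentiableAt.comp (I' := 𝓡 n) (g := Θ.symm) (f := fun y => Θ (γ y)) x
        (hΘd.mdifferentiableAt_symm (Θ.map_source hmΘ)) hd.mdifferentiableAt
    refine h1.congr_of_eventuallyEq ?_
    filter_upwards [hγ (Θ.open_source.mem_nhds hmΘ)] with y hy using (Θ.left_inv hy).symm
  rw [← mfderiv_eq_fderiv]
  exact (mfderiv_comp (I' := 𝓡 n) (g := Θ) (f := γ) x (hΘd.mdifferentiableAt hmΘ) hγ').symm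

/-- The leafwise differential, with values in the model space. -/
def modelLeafDeriv (f : W → M) (p : W) : E →L[ℝ] EuclideanSpace ℝ (Fin n) :=
  leafDeriv E F n f p

/-- The leafwise differential is defined with the preferred chart at `p`. Another chart changes it
by an automorphism of `E`, which affects neither its injectivity nor its range, so both can be read
in the chart of a flow-box. -/
theorem chartDeriv_comp_leafDeriv [IsManifold (𝓡 n) ∞ M] (hr : 1 ≤ r)
    (hW : IsFoliatedManifold E F r s W)
    {Θ : OpenPartialHomeomorph M (EuclideanSpace ℝ (Fin n))}
    (hΘ : Θ ∈ IsManifold.maximalAtlas (𝓡 n) ∞ M) {f : W → M} {p : W}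
    (h : LeafRegularAt E F n r s f p) (hp : f p ∈ Θ.source)
    {e : OpenPartialHomeomorph W (E × F)} (he : e ∈ atlas (E × F) W) (hpe : p ∈ e.source) :
    ∃ A : E ≃L[ℝ] E, (chartDeriv n Θ (f p)).comp (modelLeafDeriv (F := F) f p) =
      (fderiv ℝ (fun x => Θ (f (e.symm (x, (e p).2)))) (e p).1).comp (A : E →L[ℝ] E) := by
  have hr' : (r : WithTop ℕ∞) ≠ 0 := by
    rintro h
    have : r = 0 := by exact_mod_cast h
    simp [this] at hr
  set c := chartAt (E × F) p with hc
  have hpc : p ∈ c.source := mem_chart_source _ _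
  have hca : c ∈ atlas (E × F) W := chart_mem_atlas _ _
  obtain ⟨A, hA⟩ := exists_leaf_transition hr hW hca he hpc hpe
  refine ⟨A, ?_⟩
  have hγc : ContinuousAt (fun x => c.symm (x, (c p).2)) (c p).1 :=
    (c.continuousAt_symm (c.map_source hpc)).comp (f := fun x => (x, (c p).2)) (by fun_prop)
  have hpp : c.symm ((c p).1, (c p).2) = p := c.left_inv hpc
  have hfγc : ContinuousAt (fun x => f (c.symm (x, (c p).2))) (c p).1 :=
    ContinuousAt.comp (g := f) (f := fun x => c.symm (x, (c p).2)) (by rw [hpp]; exact h.1) hγc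
  have hd : DifferentiableAt ℝ (fun x => Θ (f (c.symm (x, (c p).2)))) (c p).1 :=
    ((h.chart hΘ hp hca hpc).contDiffAt_slice).differentiableAt hr'
  refine (chartDeriv_comp_mfderiv hΘ hfγc (by rw [hpp]) hp hd).trans ?_
  have he2 : (fun x => Θ (f (c.symm (x, (c p).2)))) =ᶠ[𝓝 (c p).1]
      (fun x => Θ (f (e.symm (x, (e p).2)))) ∘ fun x => (e (c.symm (x, (c p).2))).1 := by
    filter_upwards [eventually_transition_snd hW hca he hpc hpe,
      hγc (e.open_source.mem_nhds (by simpa [hpp] using hpe))] with x hx hx'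
    simp only [Function.comp]
    rw [← hx, Prod.mk.eta, e.left_inv hx']
  have hd2 : DifferentiableAt ℝ (fun x => Θ (f (e.symm (x, (e p).2)))) (e p).1 :=
    ((h.chart hΘ hp he hpe).contDiffAt_slice).differentiableAt hr'
  rw [he2.fderiv_eq]
  have := HasFDerivAt.comp (g := fun x => Θ (f (e.symm (x, (e p).2)))) (c p).1
    (by simpa [hpp] using hd2.hasFDerivAt) hA
  simpa [hpp] using this.fderiv

theorem injective_leafDeriv_iff [IsManifold (𝓡 n) ∞ M] (hr : 1 ≤ r)
    (hW : IsFoliatedManifold E F r s W)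
    {Θ : OpenPartialHomeomorph M (EuclideanSpace ℝ (Fin n))}
    (hΘ : Θ ∈ IsManifold.maximalAtlas (𝓡 n) ∞ M) {f : W → M} {p : W}
    (h : LeafRegularAt E F n r s f p) (hp : f p ∈ Θ.source)
    {e : OpenPartialHomeomorph W (E × F)} (he : e ∈ atlas (E × F) W) (hpe : p ∈ e.source) :
    Function.Injective (leafDeriv E F n f p) ↔
      Function.Injective (fderiv ℝ (fun x => Θ (f (e.symm (x, (e p).2)))) (e p).1) := by
  obtain ⟨A, hA⟩ := chartDeriv_comp_leafDeriv hr hW hΘ h hp he hpe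
  have h1 : (chartDeriv n Θ (f p)) ∘ (modelLeafDeriv (F := F) f p) =
      (fderiv ℝ (fun x => Θ (f (e.symm (x, (e p).2)))) (e p).1) ∘ A :=
    funext fun v => congr($hA v)
  change Function.Injective (modelLeafDeriv (F := F) f p) ↔ _
  rw [← (bijective_chartDeriv hΘ hp).1.of_comp_iff, h1,
    Function.Injective.of_comp_iff' _ A.bijective]

end LeafRegular

/-! ### Slice charts of the submanifold -/

section SliceChart

variable {n d : ℕ} {M : Type*} [TopologicalSpace M] [ChartedSpace (EuclideanSpace ℝ (Fin n)) M]
  {N : Type*} [TopologicalSpace N] [ChartedSpace (EuclideanSpace ℝ (Fin d)) N]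

variable (n d) in
/-- The derivative of a map between manifolds, as a map between the model spaces. -/
def modelDeriv (ι : N → M) (z : N) : EuclideanSpace ℝ (Fin d) →L[ℝ] EuclideanSpace ℝ (Fin n) :=
  mfderiv (𝓡 d) (𝓡 n) ι z

variable (d) in
/-- A smooth chart of `M` in which the range of `ι` is the kernel of the submersion `π`. -/
structure IsSliceChart (ι : N → M) (Θ : OpenPartialHomeomorph M (EuclideanSpace ℝ (Fin n)))
    {c : ℕ} (π : EuclideanSpace ℝ (Fin n) →L[ℝ] (Fin c → ℝ)) : Prop where
  mem_maximalAtlas : Θ ∈ IsManifold.maximalAtlas (𝓡 n) ∞ M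
  surjective : Function.Surjective π
  mem_range : ∀ m ∈ Θ.source, m ∈ range ι ↔ π (Θ m) = 0
  range_deriv : ∀ z, ι z ∈ Θ.source →
    LinearMap.range ((chartDeriv n Θ (ι z)).comp (modelDeriv n d ι z)).toLinearMap =
      LinearMap.ker π.toLinearMap

theorem exists_isSliceChart [IsManifold (𝓡 n) ∞ M] [IsManifold (𝓡 d) ∞ N] {ι : N → M}
    (hι : IsSmoothEmbedding (𝓡 d) (𝓡 n) ∞ ι) (z : N) :
    ∃ (c : ℕ) (Θ : OpenPartialHomeomorph M (EuclideanSpace ℝ (Fin n)))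
      (π : EuclideanSpace ℝ (Fin n) →L[ℝ] (Fin c → ℝ)), ι z ∈ Θ.source ∧ IsSliceChart d ι Θ π := by
  have h := hι.isImmersion.isImmersionAt z
  set D := h.domChart with hD
  set C := h.codChart with hC
  set Φ := h.equiv with hΦ
  have hwr : ∀ u ∈ D.target, C (ι (D.symm u)) = Φ (u, 0) := fun u hu => by
    have h' := IsImmersionAt.writtenInCharts h
    have := h' (x := u) (by simpa [hD] using hu)
    simpa using this
  -- The embedding property enters here: within `O`, the range of `ι` consists of the single sheet
  -- `ι '' D.source`.
  obtain ⟨O, hO, hOD⟩ := hι.isEmbedding.isOpen_iff.1 D.open_source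
  have hfd : FiniteDimensional ℝ h.complement := by
    have : FiniteDimensional ℝ (EuclideanSpace ℝ (Fin d) × h.complement) :=
      Φ.symm.toLinearEquiv.finiteDimensional
    exact FiniteDimensional.of_surjective
      (LinearMap.snd ℝ (EuclideanSpace ℝ (Fin d)) h.complement) LinearMap.snd_surjective
  set c := Module.finrank ℝ h.complement with hc
  let Ψ : h.complement ≃L[ℝ] (Fin c → ℝ) := ContinuousLinearEquiv.ofFinrankEq (by simp [hc])
  let π : EuclideanSpace ℝ (Fin n) →L[ℝ] (Fin c → ℝ) :=
    (Ψ : h.complement →L[ℝ] (Fin c → ℝ)).comp ((ContinuousLinearMap.snd ℝ (EuclideanSpace ℝ (Fin d)) _).comp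
      (Φ.symm : EuclideanSpace ℝ (Fin n) →L[ℝ] EuclideanSpace ℝ (Fin d) × h.complement))
  have hπ : ∀ v, π v = 0 ↔ (Φ.symm v).2 = 0 := fun v => by simp [π]
  -- The last condition ensures that a point with vanishing second component has a first component
  -- in `D.target`, and so comes from a point of `N`.
  let V : Set M := O ∩ (C.source ∩ C ⁻¹' ((fun v => (Φ.symm v).1) ⁻¹' D.target))
  have hV : IsOpen V := hO.inter (C.isOpen_inter_preimage (D.open_target.preimage (by fun_prop)))
  have hVs : (C.restr V).source = V := by
    rw [C.restr_source, hV.interior_eq]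
    exact inter_eq_right.2 fun m hm => hm.2.1
  have hzD : z ∈ D.source := h.mem_domChart_source
  have hDι : ∀ w, w ∈ D.source ↔ ι w ∈ O := fun w => by rw [← hOD]; rfl
  have hCι : ∀ w ∈ D.source, C (ι w) = Φ (D w, 0) := fun w hw => by
    rw [← hwr _ (D.map_source hw), D.left_inv hw]
  have hmax : C.restr V ∈ IsManifold.maximalAtlas (𝓡 n) ∞ M :=
    restr_mem_maximalAtlas _ h.codChart_mem_maximalAtlas hV
  refine ⟨c, C.restr V, π, ?_, hmax, ?_, ?_, ?_⟩
  · rw [hVs]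
    exact ⟨(hDι z).1 hzD, h.mem_codChart_source, by simp [hCι z hzD, D.map_source hzD]⟩
  · exact Ψ.surjective.comp (Prod.snd_surjective.comp Φ.symm.surjective)
  · intro m hm
    rw [hVs] at hm
    change _ ↔ π (C m) = 0
    rw [hπ]
    constructor
    · rintro ⟨w, rfl⟩
      simp [hCι w ((hDι w).2 hm.1)]
    · intro h0
      refine ⟨D.symm (Φ.symm (C m)).1, C.injOn (h.source_subset_preimage_source
        (D.map_target hm.2.2)) hm.2.1 ?_⟩
      rw [hwr _ hm.2.2, ← h0, Prod.mk.eta, Φ.apply_symm_apply]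
  · intro w hw
    have hwV := hw
    rw [hVs] at hwV
    have hwD := (hDι w).2 hwV.1
    have hDd : D.MDifferentiable (𝓡 d) (𝓡 d) :=
      mdifferentiable_of_mem_maximalAtlas h.domChart_mem_maximalAtlas
    have e1 : (chartDeriv n (C.restr V) (ι w)).comp (modelDeriv n d ι w) =
        ((Φ : EuclideanSpace ℝ (Fin d) × h.complement →L[ℝ] EuclideanSpace ℝ (Fin n)).comp (ContinuousLinearMap.inl ℝ _ _)).comp
          (chartDeriv d D w) := by
      have hι' : MDifferentiableAt (𝓡 d) (𝓡 n) ι w :=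
        (hι.contMDiff w).mdifferentiableAt (by simp)
      have a1 := mfderiv_comp (I' := 𝓡 n) (g := C.restr V) (f := ι) w
        ((mdifferentiable_of_mem_maximalAtlas hmax).mdifferentiableAt hw) hι'
      have a2 := mfderiv_comp (I' := 𝓡 d) (I'' := 𝓡 n) (g := fun u => Φ (u, 0)) (f := D) w
        (DifferentiableAt.mdifferentiableAt (by fun_prop)) (hDd.mdifferentiableAt hwD)
      have a3 : (C.restr V) ∘ ι =ᶠ[𝓝 w] (fun u => Φ (u, 0)) ∘ D := by
        filter_upwards [D.open_source.mem_nhds hwD] with u hu using hCι u hu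
      have a4 : fderiv ℝ (fun u => Φ (u, 0)) (D w) =
          (Φ : EuclideanSpace ℝ (Fin d) × h.complement →L[ℝ] EuclideanSpace ℝ (Fin n)).comp (ContinuousLinearMap.inl ℝ _ _) :=
        (((Φ : EuclideanSpace ℝ (Fin d) × h.complement →L[ℝ] EuclideanSpace ℝ (Fin n)).comp
          (ContinuousLinearMap.inl ℝ _ _)).hasFDerivAt (x := D w)).fderiv
      rw [mfderiv_eq_fderiv, a4, ← a3.mfderiv_eq, a1] at a2
      exact a2
    rw [e1]
    ext v
    simp only [LinearMap.mem_range, LinearMap.mem_ker, ContinuousLinearMap.coe_coe, hπ]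
    constructor
    · rintro ⟨u, rfl⟩
      simp
    · intro hv
      obtain ⟨u, hu⟩ := (bijective_chartDeriv h.domChart_mem_maximalAtlas hwD).2 (Φ.symm v).1
      refine ⟨u, ?_⟩
      simp only [ContinuousLinearMap.comp_apply]
      rw [hu]
      simp [← hv]

variable {E F : Type*} [NormedAddCommGroup E] [NormedSpace ℝ E]
  [NormedAddCommGroup F] [NormedSpace ℝ F]
  {W : Type*} [TopologicalSpace W] [ChartedSpace (E × F) W] {r s : ℕ∞}

/-- The derivative of `Θ` carries the tangent space of `N` onto `ker π`, and `range D + ker π` is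
everything exactly when `π ∘ D` is onto. Off the range of `ι`, transversality is vacuous. -/
theorem IsSliceChart.transversal_iff [IsManifold (𝓡 n) ∞ M] (hr : 1 ≤ r)
    (hW : IsFoliatedManifold E F r s W) {ι : N → M}
    {Θ : OpenPartialHomeomorph M (EuclideanSpace ℝ (Fin n))}
    {c : ℕ} {π : EuclideanSpace ℝ (Fin n) →L[ℝ] (Fin c → ℝ)} (hΘ : IsSliceChart d ι Θ π)
    {f : W → M} {p : W} (h : LeafRegularAt E F n r s f p) (hp : f p ∈ Θ.source)
    {e : OpenPartialHomeomorph W (E × F)} (he : e ∈ atlas (E × F) W) (hpe : p ∈ e.source) :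
    IntersectsTransversally E F n d f {p} ι ↔ π (Θ (f p)) ≠ 0 ∨
      Function.Surjective (π.comp (fderiv ℝ (fun x => Θ (f (e.symm (x, (e p).2)))) (e p).1)) := by
  obtain ⟨A, hA⟩ := chartDeriv_comp_leafDeriv hr hW hΘ.mem_maximalAtlas h hp he hpe
  set D := fderiv ℝ (fun x => Θ (f (e.symm (x, (e p).2)))) (e p).1
  set B := chartDeriv n Θ (f p) with hB
  have hBb : Function.Bijective B := bijective_chartDeriv hΘ.mem_maximalAtlas hp
  have key : ∀ z, f p = ι z → (LinearMap.range (modelLeafDeriv (E := E) (F := F) f p).toLinearMap ⊔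
      LinearMap.range (modelDeriv n d ι z).toLinearMap = ⊤ ↔
      Function.Surjective (π.comp D)) := by
    intro z hz
    have hker := hΘ.range_deriv z (hz ▸ hp)
    rw [← hz, ← hB] at hker
    have hDr : LinearMap.range (B.comp (modelLeafDeriv (E := E) (F := F) f p)).toLinearMap =
        LinearMap.range D.toLinearMap := by
      rw [hA]
      ext v
      constructor
      · rintro ⟨u, rfl⟩
        exact ⟨A u, rfl⟩
      · rintro ⟨u, rfl⟩
        exact ⟨A.symm u, by simp⟩
    have h1 : ∀ R : Submodule ℝ (EuclideanSpace ℝ (Fin n)), R = ⊤ ↔ R.map B.toLinearMap = ⊤ := by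
      intro R
      constructor
      · rintro rfl
        rw [Submodule.map_top, LinearMap.range_eq_top]
        exact hBb.2
      · intro hR
        apply Submodule.map_injective_of_injective (f := B.toLinearMap) hBb.1
        rw [hR, Submodule.map_top, eq_comm, LinearMap.range_eq_top]
        exact hBb.2
    have h2 : ∀ L : EuclideanSpace ℝ (Fin d) →L[ℝ] EuclideanSpace ℝ (Fin n),
      (LinearMap.range L.toLinearMap).map B.toLinearMap = LinearMap.range (B.comp L).toLinearMap :=
      fun L => (LinearMap.range_comp _ _).symm
    have h2' : ∀ L : E →L[ℝ] EuclideanSpace ℝ (Fin n),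
      (LinearMap.range L.toLinearMap).map B.toLinearMap = LinearMap.range (B.comp L).toLinearMap :=
      fun L => (LinearMap.range_comp _ _).symm
    rw [h1, Submodule.map_sup, h2, h2', hker, hDr]
    rw [Submodule.eq_top_iff']
    constructor
    · intro hs v
      obtain ⟨w, rfl⟩ := hΘ.surjective v
      obtain ⟨_, ⟨x, rfl⟩, k, hk, hxk⟩ := Submodule.mem_sup.1 (hs w)
      refine ⟨x, ?_⟩
      have hk : π k = 0 := hk
      have hxk : D x + k = w := hxk
      rw [← hxk, map_add, hk, add_zero, ContinuousLinearMap.comp_apply]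
    · intro hs w
      obtain ⟨x, hx⟩ := hs (π w)
      refine Submodule.mem_sup.2 ⟨D x, ⟨x, rfl⟩, w - D x, ?_, by abel⟩
      change π (w - D x) = 0
      rw [map_sub, ← hx, ContinuousLinearMap.comp_apply, sub_self]
  constructor
  · intro ht
    by_cases h0 : π (Θ (f p)) = 0
    · obtain ⟨z, hz⟩ := (hΘ.mem_range _ hp).2 h0
      exact Or.inr ((key z hz.symm).1 (ht p rfl z hz.symm))
    · exact Or.inl h0
  · rintro h0 q rfl z hz
    have hz0 : π (Θ (f q)) = 0 := (hΘ.mem_range _ hp).1 ⟨z, hz.symm⟩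
    exact (key z hz).2 (h0.resolve_left (by simp [hz0]))

end SliceChart

/-! ### Regular approximation on a plaque by a dimension count -/

section RegularApproximation

variable {E G : Type*} [NormedAddCommGroup E] [NormedSpace ℝ E] [FiniteDimensional ℝ E]
  [NormedAddCommGroup G] [NormedSpace ℝ G] [FiniteDimensional ℝ G]

omit [FiniteDimensional ℝ E] in
/-- If linear forms are not jointly surjective, then one of them is a combination of the others. -/
theorem exists_eq_sum_of_not_surjective {c : ℕ} (B : E →L[ℝ] (Fin c → ℝ))
    (hB : ¬ Function.Surjective B) :
    ∃ (i : Fin c) (a : {j // j ≠ i} → ℝ), ∀ x, B x i = ∑ j, a j * B x j := by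
  have hlt : LinearMap.range B.toLinearMap < ⊤ :=
    lt_top_iff_ne_top.2 fun h => hB (LinearMap.range_eq_top.1 h)
  obtain ⟨w, hw0, hw⟩ := Submodule.exists_le_ker_of_lt_top _ hlt
  have hsum : ∀ v : Fin c → ℝ, w v = ∑ j, v j * w (Pi.single j 1) := fun v => by
    conv_lhs => rw [← Finset.univ_sum_single v, map_sum]
    refine Finset.sum_congr rfl fun j _ => ?_
    rw [← smul_eq_mul, ← map_smul, ← Pi.single_smul', smul_eq_mul, mul_one]
  obtain ⟨i, hi⟩ : ∃ i, w (Pi.single i 1) ≠ 0 := by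
    by_contra! h
    exact hw0 (LinearMap.ext fun v => by rw [hsum]; simp [h])
  -- The coefficients come from solving `w (B x) = 0` for the coordinate `i`.
  refine ⟨i, fun j => -(w (Pi.single j.1 1) / w (Pi.single i 1)), fun x => ?_⟩
  have h0 : w (B x) = 0 := hw ⟨x, rfl⟩
  rw [hsum, ← Finset.add_sum_erase _ _ (Finset.mem_univ i)] at h0
  have h1 : ∑ j ∈ Finset.univ.erase i, B x j * w (Pi.single j 1) =
      ∑ j : {j // j ≠ i}, B x j * w (Pi.single j.1 1) :=
    (Finset.sum_subtype (Finset.univ.erase i) (p := fun j => j ≠ i) (by simp)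
      fun j => B x j * w (Pi.single j 1))
  rw [h1] at h0
  have h2 : B x i = -(∑ j : {j // j ≠ i}, B x j * w (Pi.single j.1 1)) / w (Pi.single i 1) := by
    field_simp; linarith
  rw [h2, neg_div, Finset.sum_div, ← Finset.sum_neg_distrib]
  exact Finset.sum_congr rfl fun j _ => by ring

/-- A bad pair `b` is determined by a bad point `x`, the index `i` of a dependent row of the
perturbed derivative, the `c - 1` coefficients of the dependence and the `c - 1` other rows. With `k
= dim E`, these are `k + (c - 1) + (c - 1) k = (c k + c) - 1` parameters, one fewer than the
dimension of the space of pairs. A `C^1` image cannot make up the difference in Hausdorff dimension,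
so the good pairs are dense. -/
theorem dense_regular_affine_perturbation {c : ℕ} {g : E → Fin c → ℝ} (hg : ContDiff ℝ ∞ g) :
    Dense {b : (Fin c → E →L[ℝ] ℝ) × (Fin c → ℝ) | ∀ x, (∀ j, g x j + b.1 j x + b.2 j = 0) →
      Function.Surjective (fderiv ℝ g x + ContinuousLinearMap.pi b.1)} := by
  -- For `c = 0` the parameter space has dimension zero, and even the empty bad set does not have
  -- strictly smaller dimension.
  rcases Nat.eq_zero_or_pos c with rfl | hc
  · convert dense_univ
    exact eq_univ_of_forall fun b x _ => Function.surjective_to_subsingleton _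
  let P : Fin c → Type _ := fun i => E × ({j // j ≠ i} → ℝ) × ({j // j ≠ i} → E →L[ℝ] ℝ)
  -- The linear part of `b` is the perturbed derivative, with row `i` rebuilt from the others, minus
  -- the derivative of `g`. The constant part is then forced by the vanishing at `q.1`.
  let row : ∀ i, P i → Fin c → E →L[ℝ] ℝ := fun i q j =>
    (if h : j = i then ∑ m, q.2.1 m • q.2.2 m else q.2.2 ⟨j, h⟩) -
      (ContinuousLinearMap.proj j).comp (fderiv ℝ g q.1)
  let bad : ∀ i, P i → (Fin c → E →L[ℝ] ℝ) × (Fin c → ℝ) := fun i q =>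
    (row i q, fun j => - g q.1 j - row i q j q.1)
  have hsub : {b : (Fin c → E →L[ℝ] ℝ) × (Fin c → ℝ) |
      ∀ x, (∀ j, g x j + b.1 j x + b.2 j = 0) →
      Function.Surjective (fderiv ℝ g x + ContinuousLinearMap.pi b.1)}ᶜ ⊆ ⋃ i, range (bad i) := by
    intro b hb
    simp only [mem_compl_iff, mem_ofPred_eq, not_forall] at hb
    obtain ⟨x, hx, hns⟩ := hb
    obtain ⟨i, a, ha⟩ := exists_eq_sum_of_not_surjective _ hns
    have hrow : row i (x, a, fun j => (ContinuousLinearMap.proj j.1).comp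
        (fderiv ℝ g x + ContinuousLinearMap.pi b.1)) = b.1 := by
      funext j
      ext y
      by_cases h : j = i
      · subst h
        have := ha y
        simp only [add_apply, Pi.add_apply, ContinuousLinearMap.coe_pi'] at this
        have : ∑ m, a m * (fderiv ℝ g x y m + b.1 m y) - fderiv ℝ g x y j = b.1 j y := by
          rw [← this]; ring
        simpa [row, mul_add] using this
      · simp [row, h]
    refine mem_iUnion.2 ⟨i, (x, a, fun j => (ContinuousLinearMap.proj j.1).comp
      (fderiv ℝ g x + ContinuousLinearMap.pi b.1)), Prod.ext hrow (funext fun j => ?_)⟩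
    simp only [bad]
    rw [hrow]
    linarith [hx j]
  have hdiff : ∀ i, ContDiff ℝ 1 (bad i) := by
    intro i
    have hg' : ContDiff ℝ 1 (fderiv ℝ g) := hg.fderiv_right (by norm_cast)
    have hg1 : ContDiff ℝ 1 g := hg.of_le (by norm_cast)
    have hrow : ∀ j, ContDiff ℝ 1 fun q : P i => row i q j := by
      intro j
      refine ContDiff.sub ?_ (contDiff_const.clm_comp (hg'.comp contDiff_fst))
      by_cases h : j = i
      · simp only [h, dif_pos]
        fun_prop
      · simp only [h, dif_neg, not_false_eq_true]
        fun_prop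
    refine (contDiff_pi.2 hrow).prodMk (contDiff_pi.2 fun j => ?_)
    refine ContDiff.sub ?_ ((hrow j).clm_apply contDiff_fst)
    exact ((contDiff_pi.1 hg1 j).comp contDiff_fst).neg
  have hdim : dimH {b : (Fin c → E →L[ℝ] ℝ) × (Fin c → ℝ) |
      ∀ x, (∀ j, g x j + b.1 j x + b.2 j = 0) →
      Function.Surjective (fderiv ℝ g x + ContinuousLinearMap.pi b.1)}ᶜ <
      Module.finrank ℝ ((Fin c → E →L[ℝ] ℝ) × (Fin c → ℝ)) := by
    refine (dimH_mono hsub).trans_lt ?_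
    have hdual : Module.finrank ℝ (E →L[ℝ] ℝ) = Module.finrank ℝ E := by
      rw [← LinearMap.toContinuousLinearMap.finrank_eq]
      simp
    rw [dimH_iUnion]
    have hP : ∀ i, Module.finrank ℝ (P i) =
        Module.finrank ℝ E + ((c - 1) + (c - 1) * Module.finrank ℝ E) := fun i => by
      simp [P, Module.finrank_prod, Module.finrank_pi_fintype, hdual]
    refine lt_of_le_of_lt (iSup_le fun i => (hdiff i).dimH_range_le.trans_eq
      (congrArg Nat.cast (hP i))) (Nat.cast_lt.2 ?_)
    obtain ⟨m, rfl⟩ : ∃ m, c = m + 1 := ⟨c - 1, by omega⟩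
    simp only [Module.finrank_prod, Module.finrank_pi_fintype, hdual, Finset.sum_const,
      Finset.card_univ, Fintype.card_fin, smul_eq_mul, Module.finrank_self, add_tsub_cancel_right]
    linarith
  have := dense_compl_of_dimH_lt_finrank hdim
  rwa [compl_compl] at this

/-- Convolution with a normalized bump commutes with differentiation, and compact support makes both
`w` and its derivative uniformly continuous. One radius serves both estimates. -/
theorem exists_contDiff_approx [MeasurableSpace E] [BorelSpace E] {w : E → G}
    (hw : ContDiff ℝ 1 w) (hc : HasCompactSupport w) {ε : ℝ} (hε : 0 < ε) :
    ∃ g : E → G, ContDiff ℝ ∞ g ∧ ∀ x, dist (g x) (w x) ≤ ε ∧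
      dist (fderiv ℝ g x) (fderiv ℝ w x) ≤ ε := by
  have hw' : Continuous (fderiv ℝ w) := hw.continuous_fderiv (by simp)
  have u1 := Metric.uniformContinuous_iff.1 (hc.uniformContinuous_of_continuous hw.continuous) ε hε
  have u2 := Metric.uniformContinuous_iff.1 ((hc.fderiv ℝ).uniformContinuous_of_continuous hw') ε hε
  obtain ⟨δ₁, h1, u1⟩ := u1
  obtain ⟨δ₂, h2, u2⟩ := u2
  let μ : MeasureTheory.Measure E := MeasureTheory.Measure.addHaar
  let φ : ContDiffBump (0 : E) := ⟨min δ₁ δ₂ / 2, min δ₁ δ₂, by positivity, by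
    have : 0 < min δ₁ δ₂ := lt_min h1 h2
    linarith⟩
  have hφc : Continuous (φ.normed μ) := φ.continuous_normed
  refine ⟨MeasureTheory.convolution (φ.normed μ) w (ContinuousLinearMap.lsmul ℝ ℝ) μ,
    φ.hasCompactSupport_normed.contDiff_convolution_left _ φ.contDiff_normed
      hw.continuous.locallyIntegrable, fun x => ⟨?_, ?_⟩⟩
  · exact φ.dist_normed_convolution_le hw.continuous.aestronglyMeasurable fun y hy =>
      (u1 (lt_of_lt_of_le hy (min_le_left _ _))).le
  · rw [(hc.hasFDerivAt_convolution_right (ContinuousLinearMap.lsmul ℝ ℝ)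
      hφc.locallyIntegrable hw x).fderiv]
    have : (ContinuousLinearMap.lsmul ℝ ℝ : ℝ →L[ℝ] G →L[ℝ] G).precompR E =
        ContinuousLinearMap.lsmul ℝ ℝ := by
      ext; simp
    rw [this]
    exact φ.dist_normed_convolution_le hw'.aestronglyMeasurable fun y hy =>
      (u2 (lt_of_lt_of_le hy (min_le_right _ _))).le

/-- A cut-off equal to `1` near `K` reduces to a compactly supported `C^1` map with the same 1-jets
along `K`. -/
theorem exists_contDiff_approx_on_compact {u : E → G} {K : Set E} (hK : IsCompact K)
    (hu : ∀ x ∈ K, ContDiffAt ℝ 1 u x) {ε : ℝ} (hε : 0 < ε) :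
    ∃ g : E → G, ContDiff ℝ ∞ g ∧ ∀ x ∈ K, dist (g x) (u x) ≤ ε ∧
      dist (fderiv ℝ g x) (fderiv ℝ u x) ≤ ε := by
  borelize E
  let V : Set E := interior {x | ContDiffAt ℝ 1 u x}
  have hKV : K ⊆ V := fun x hx =>
    mem_interior_iff_mem_nhds.2 ((hu x hx).eventually (by simp))
  have hVu : ∀ x ∈ V, ContDiffAt ℝ 1 u x := fun x hx => interior_subset hx
  obtain ⟨K₁, hK₁, hKK₁, hK₁V⟩ := exists_compact_between hK isOpen_interior hKV
  obtain ⟨χ, hχ1, hχ0, -⟩ := exists_contMDiffMap_one_nhds_of_subset_interior (n := ⊤) 𝓘(ℝ, E)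
    hK.isClosed hKK₁
  have hχc : ContDiff ℝ ∞ χ := χ.contMDiff.contDiff
  have hsupp : tsupport χ ⊆ K₁ := closure_minimal (fun x hx => by
    by_contra h
    exact hx (hχ0 x h)) hK₁.isClosed
  have hcd : ContDiff ℝ 1 fun x => χ x • u x := by
    rw [contDiff_iff_contDiffAt]
    intro x
    by_cases hx : x ∈ tsupport χ
    · exact (hχc.of_le (by norm_cast)).contDiffAt.smul (hVu x (hK₁V (hsupp hx)))
    · have : (fun x => χ x • u x) =ᶠ[𝓝 x] fun _ => 0 := by
        filter_upwards [(isClosed_tsupport χ).isOpen_compl.mem_nhds hx] with y hy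
        rw [image_eq_zero_of_notMem_tsupport hy, zero_smul]
      exact contDiffAt_const.congr_of_eventuallyEq this
  have hχs : HasCompactSupport χ := hK₁.of_isClosed_subset (isClosed_tsupport χ) hsupp
  have hcs : HasCompactSupport fun x => χ x • u x := hχs.smul_right
  obtain ⟨g, hg, hgw⟩ := exists_contDiff_approx hcd hcs hε
  refine ⟨g, hg, fun x hx => ?_⟩
  have : (fun x => χ x • u x) =ᶠ[𝓝 x] u := by
    filter_upwards [hχ1.filter_mono (nhds_le_nhdsSet hx)] with y hy
    rw [hy, one_smul]
  have h := hgw x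
  rw [this.fderiv_eq] at h
  rwa [this.eq_of_nhds] at h

/-- The affine perturbation found for `π ∘ h`, where `h` is a mollification of `u`, is lifted to `G`
by a linear right inverse `σ` of `π`. Half of `ε` goes to the mollification and half to the
perturbation. -/
theorem exists_regular_approx_on_compact {c : ℕ} {π : G →L[ℝ] (Fin c → ℝ)}
    (hπ : Function.Surjective π) {u : E → G} {K : Set E} (hK : IsCompact K)
    (hu : ∀ x ∈ K, ContDiffAt ℝ 1 u x) {ε : ℝ} (hε : 0 < ε) :
    ∃ g : E → G, ContDiff ℝ ∞ g ∧ ∀ x ∈ K, dist (g x) (u x) < ε ∧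
      dist (fderiv ℝ g x) (fderiv ℝ u x) < ε ∧
      (π (g x) ≠ 0 ∨ Function.Surjective (π.comp (fderiv ℝ g x))) := by
  obtain ⟨h, hh, hhu⟩ := exists_contDiff_approx_on_compact hK hu (half_pos hε)
  obtain ⟨σ', hσ'⟩ := π.toLinearMap.exists_rightInverse_of_surjective
    (LinearMap.range_eq_top.2 hπ)
  let σ : (Fin c → ℝ) →L[ℝ] G := LinearMap.toContinuousLinearMap σ'
  have hσ : ∀ v, π (σ v) = v := fun v => congr($hσ' v)
  have hsmall : ∀ᶠ b : (Fin c → E →L[ℝ] ℝ) × (Fin c → ℝ) in 𝓝 0, ∀ x ∈ K,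
      dist (σ (ContinuousLinearMap.pi b.1 x + b.2)) 0 < ε / 2 ∧
      dist (σ.comp (ContinuousLinearMap.pi b.1)) 0 < ε / 2 := by
    have hpi : Continuous fun b : (Fin c → E →L[ℝ] ℝ) => ContinuousLinearMap.pi b :=
      LinearMap.continuous_of_finiteDimensional
        ({ toFun := fun b => ContinuousLinearMap.pi b
           map_add' := fun _ _ => rfl
           map_smul' := fun _ _ => rfl } : (Fin c → E →L[ℝ] ℝ) →ₗ[ℝ] (E →L[ℝ] (Fin c → ℝ)))
    refine hK.eventually_forall_of_forall_eventually fun x _ => ?_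
    have c1 : Continuous fun z : ((Fin c → E →L[ℝ] ℝ) × (Fin c → ℝ)) × E =>
        dist (σ (ContinuousLinearMap.pi z.1.1 z.2 + z.1.2)) 0 := by fun_prop
    have c2 : Continuous fun z : ((Fin c → E →L[ℝ] ℝ) × (Fin c → ℝ)) × E =>
        dist (σ.comp (ContinuousLinearMap.pi z.1.1)) 0 := by
      have : Continuous fun z : ((Fin c → E →L[ℝ] ℝ) × (Fin c → ℝ)) × E =>
        ContinuousLinearMap.pi z.1.1 := hpi.comp (by fun_prop)
      fun_prop
    have z0 : ContinuousLinearMap.pi (0 : Fin c → E →L[ℝ] ℝ) = 0 := rfl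
    exact (c1.continuousAt.eventually_lt continuousAt_const (by simp [z0, hε])).and
      (c2.continuousAt.eventually_lt continuousAt_const (by simp [z0, hε]))
  obtain ⟨b, hb1, hb2⟩ := (dense_regular_affine_perturbation
    (π.contDiff.comp hh)).inter_nhds_nonempty hsmall
  have hcd : ContDiff ℝ ∞ fun x => h x + σ (ContinuousLinearMap.pi b.1 x + b.2) := by fun_prop
  have hfd : ∀ x, fderiv ℝ (fun x => h x + σ (ContinuousLinearMap.pi b.1 x + b.2)) x =
      fderiv ℝ h x + σ.comp (ContinuousLinearMap.pi b.1) := fun x => by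
    refine HasFDerivAt.fderiv (HasFDerivAt.add (hh.differentiable (by simp) x).hasFDerivAt ?_)
    exact σ.hasFDerivAt.comp x ((ContinuousLinearMap.pi b.1).hasFDerivAt.add_const b.2)
  have hπfd : ∀ x, fderiv ℝ (π ∘ h) x = π.comp (fderiv ℝ h x) := fun x =>
    (π.hasFDerivAt.comp x (hh.differentiable (by simp) x).hasFDerivAt).fderiv
  refine ⟨_, hcd, fun x hx => ⟨?_, ?_, ?_⟩⟩
  · calc dist (h x + σ (ContinuousLinearMap.pi b.1 x + b.2)) (u x)
        ≤ dist (h x + σ (ContinuousLinearMap.pi b.1 x + b.2)) (h x) + dist (h x) (u x) :=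
          dist_triangle _ _ _
      _ < ε / 2 + ε / 2 := by
          refine add_lt_add_of_lt_of_le ?_ (hhu x hx).1
          simpa using (hb2 x hx).1
      _ = ε := add_halves ε
  · rw [hfd]
    calc dist (fderiv ℝ h x + σ.comp (ContinuousLinearMap.pi b.1)) (fderiv ℝ u x)
        ≤ dist (fderiv ℝ h x + σ.comp (ContinuousLinearMap.pi b.1)) (fderiv ℝ h x) +
          dist (fderiv ℝ h x) (fderiv ℝ u x) := dist_triangle _ _ _
      _ < ε / 2 + ε / 2 := by
          refine add_lt_add_of_lt_of_le ?_ (hhu x hx).2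
          simpa using (hb2 x hx).2
      _ = ε := add_halves ε
  · rw [or_iff_not_imp_left, not_not]
    intro h0
    have hs := hb1 x fun j => by
      have := congrFun h0 j
      simpa [map_add, hσ, add_assoc] using this
    rw [hfd, ContinuousLinearMap.comp_add]
    have : π.comp (σ.comp (ContinuousLinearMap.pi b.1)) = ContinuousLinearMap.pi b.1 := by
      ext v j
      simp [hσ]
    rw [this, ← hπfd]
    exact hs

end RegularApproximation

/-! ### Cantor transversals: locally constant choices and boxes -/

section CantorBoxes

/-- `K` has arbitrarily small neighbourhoods whose boundaries miss `K`. -/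
def HasSeparatedNhds {F : Type*} [TopologicalSpace F] (K : Set F) : Prop :=
  ∀ y ∈ K, ∀ U ∈ 𝓝 y, ∃ O, IsOpen O ∧ y ∈ O ∧ O ⊆ U ∧ closure O ∩ K ⊆ O

/-- Only compactness and total disconnectedness matter. A small clopen piece of `K` and its
complement in `K` are disjoint closed sets of `F`, which normality separates. -/
theorem hasSeparatedNhds_of_cantor {F : Type*} [TopologicalSpace F] [T2Space F] [NormalSpace F]
    {K : Set F} (h : Nonempty (K ≃ₜ cantorSet)) : IsCompact K ∧ HasSeparatedNhds K := by
  obtain ⟨h⟩ := h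
  have hc : CompactSpace cantorSet := isCompact_iff_compactSpace.1 isCompact_cantorSet
  have hK : CompactSpace K := h.symm.compactSpace
  have htd : TotallyDisconnectedSpace K := by
    have := cantorSetHomeomorphNatToBool.symm.totallyDisconnectedSpace
    exact h.symm.totallyDisconnectedSpace
  refine ⟨isCompact_iff_compactSpace.2 hK, fun y hy U hU => ?_⟩
  obtain ⟨U', hU'U, hU', hyU'⟩ := mem_nhds_iff.1 hU
  obtain ⟨Z, hZ, hyZ, hZU⟩ := compact_exists_isClopen_in_isOpen
    (hU'.preimage (continuous_subtype_val (p := (· ∈ K)))) (x := ⟨y, hy⟩) hyU'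
  have h1 : IsClosed (Subtype.val '' Z) :=
    (hZ.isClosed.isCompact.image continuous_subtype_val).isClosed
  have h2 : IsClosed (Subtype.val '' Zᶜ) :=
    (hZ.compl.isClosed.isCompact.image continuous_subtype_val).isClosed
  have h3 : Subtype.val '' Z ⊆ U' ∩ (Subtype.val '' Zᶜ)ᶜ := by
    rintro _ ⟨w, hw, rfl⟩
    refine ⟨hZU hw, ?_⟩
    rintro ⟨w', hw', hww⟩
    exact hw' (Subtype.ext hww ▸ hw)
  obtain ⟨O, hO, hZO, hOU⟩ := normal_exists_closure_subset h1 (hU'.inter h2.isOpen_compl) h3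
  refine ⟨O, hO, hZO ⟨_, hyZ, rfl⟩, fun w hw => hU'U (hOU (subset_closure hw)).1, ?_⟩
  rintro w ⟨hwO, hwK⟩
  by_cases hwZ : (⟨w, hwK⟩ : K) ∈ Z
  · exact hZO ⟨_, hwZ, rfl⟩
  · exact absurd ⟨_, hwZ, rfl⟩ (hOU hwO).2

theorem HasSeparatedNhds.mono {F : Type*} [TopologicalSpace F] {K K' : Set F}
    (h : HasSeparatedNhds K) (hK : K' ⊆ K) : HasSeparatedNhds K' := fun y hy U hU => by
  obtain ⟨O, hO, hyO, hOU, hOK⟩ := h y (hK hy) U hU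
  exact ⟨O, hO, hyO, hOU, fun w hw => hOK ⟨hw.1, hK hw.2⟩⟩

/-- Local solutions are patched without interpolation, by switching from one to the other across a
boundary that misses `K`. The result is locally constant on an open set of `F`, and not merely on
`K`, because the perturbation must be regular on a neighbourhood of `S` in `W`. -/
theorem HasSeparatedNhds.exists_locally_constant_choice {F : Type*} [TopologicalSpace F]
    {K U : Set F} (hK : IsCompact K) (h : HasSeparatedNhds K) (hU : IsOpen U) (hKU : K ⊆ U)
    {α : Type*} [Nonempty α] {R : F → α → Prop}
    (hR : ∀ y ∈ K, ∃ a, ∀ᶠ y' in 𝓝 y, y' ∈ K → R y' a) :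
    ∃ (O : Set F) (c : F → α), IsOpen O ∧ K ⊆ O ∧ O ⊆ U ∧
      (∀ y ∈ O, ∀ᶠ y' in 𝓝 y, c y' = c y) ∧ ∀ y ∈ K, R y (c y) := by
  -- Compactness induction over sets `A` that need not lie in `K`, hence the form `A ∩ K`. The
  -- condition on `closure O` is carried along so that `O₁` and `O₂ \ closure O₁` still cover the
  -- points of `K` in the two domains.
  have key : ∃ (O : Set F) (c : F → α), IsOpen O ∧ K ∩ K ⊆ O ∧ O ⊆ U ∧ closure O ∩ K ⊆ O ∧
      (∀ y ∈ O, ∀ᶠ y' in 𝓝 y, c y' = c y) ∧ ∀ y ∈ K ∩ O, R y (c y) := by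
    refine hK.induction_on (p := fun A => ∃ (O : Set F) (c : F → α), IsOpen O ∧ A ∩ K ⊆ O ∧ O ⊆ U ∧
      closure O ∩ K ⊆ O ∧ (∀ y ∈ O, ∀ᶠ y' in 𝓝 y, c y' = c y) ∧ ∀ y ∈ K ∩ O, R y (c y))
      ?_ ?_ ?_ ?_
    · exact ⟨∅, fun _ => Classical.arbitrary α, by simp⟩
    · rintro A B hAB ⟨O, c, hO, hB, h⟩
      exact ⟨O, c, hO, fun y hy => hB ⟨hAB hy.1, hy.2⟩, h⟩
    · rintro A B ⟨O₁, c₁, hO₁, hA, hU₁, hcl₁, hc₁, hR₁⟩ ⟨O₂, c₂, hO₂, hB, hU₂, hcl₂, hc₂, hR₂⟩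
      have hmem : ∀ y ∈ K, y ∈ closure O₁ ∪ closure O₂ → y ∈ O₁ ∪ (O₂ \ closure O₁) := by
        intro y hyK hy
        by_cases hy1 : y ∈ closure O₁
        · exact Or.inl (hcl₁ ⟨hy1, hyK⟩)
        · exact Or.inr ⟨hcl₂ ⟨hy.resolve_left hy1, hyK⟩, hy1⟩
      have hO₂' : IsOpen (O₂ \ closure O₁) := hO₂.sdiff isClosed_closure
      classical
      refine ⟨O₁ ∪ (O₂ \ closure O₁), O₁.piecewise c₁ c₂, hO₁.union hO₂', ?_,
        union_subset hU₁ (sdiff_subset.trans hU₂), ?_, ?_, ?_⟩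
      · rintro y ⟨hy | hy, hyK⟩
        · exact Or.inl (hA ⟨hy, hyK⟩)
        · exact hmem y hyK (Or.inr (subset_closure (hB ⟨hy, hyK⟩)))
      · rintro y ⟨hy, hyK⟩
        refine hmem y hyK ?_
        rw [← closure_union]
        exact closure_mono (union_subset_union_right _ sdiff_subset) hy
      · rintro y (hy | hy)
        · filter_upwards [hO₁.mem_nhds hy, hc₁ y hy] with z hz hz'
          rw [piecewise_eq_of_mem _ _ _ hz, piecewise_eq_of_mem _ _ _ hy, hz']
        · have hn : ∀ z ∈ O₂ \ closure O₁, z ∉ O₁ := fun z hz hz1 => hz.2 (subset_closure hz1)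
          filter_upwards [hO₂'.mem_nhds hy, hc₂ y hy.1] with z hz hz'
          rw [piecewise_eq_of_notMem _ _ _ (hn z hz), piecewise_eq_of_notMem _ _ _ (hn y hy), hz']
      · rintro y ⟨hyK, hy | hy⟩
        · rw [piecewise_eq_of_mem _ _ _ hy]
          exact hR₁ y ⟨hyK, hy⟩
        · rw [piecewise_eq_of_notMem _ _ _ fun h => hy.2 (subset_closure h)]
          exact hR₂ y ⟨hyK, hy.1⟩
    · intro y hy
      obtain ⟨a, ha⟩ := hR y hy
      obtain ⟨O, hO, hyO, hOU, hcl⟩ := h y hy _ (inter_mem ha (hU.mem_nhds (hKU hy)))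
      exact ⟨O, mem_nhdsWithin_of_mem_nhds (hO.mem_nhds hyO), O, fun _ => a, hO, inter_subset_left,
        fun z hz => (hOU hz).2, hcl, fun _ _ => Eventually.of_forall fun _ => rfl,
        fun z hz => (hOU hz.2).1 hz.1⟩
  obtain ⟨O, c, hO, hKO, hOU, -, hc, hR⟩ := key
  rw [inter_self] at hKO
  exact ⟨O, c, hO, hKO, hOU, hc, fun y hy => hR y ⟨hy, hKO hy⟩⟩

variable {E F : Type*} [NormedAddCommGroup E] [NormedSpace ℝ E]
  [NormedAddCommGroup F] [NormedSpace ℝ F] {W : Type*} [TopologicalSpace W]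
  [ChartedSpace (E × F) W]

/-- A box of the solenoid `S` in the chart `e`: over the closed ball `closedBall x₀ δ` and the
closure of `O`, the solenoid is the product with the compact set `K ⊆ O`. -/
structure IsSolenoidBox (S : Set W) (e : OpenPartialHomeomorph W (E × F)) (x₀ : E) (δ : ℝ)
    (O K : Set F) : Prop where
  mem_atlas : e ∈ atlas (E × F) W
  pos : 0 < δ
  isOpen : IsOpen O
  isCompact : IsCompact K
  subset : K ⊆ O
  isCompact_closure : IsCompact (closure O)
  subset_target : Metric.closedBall x₀ δ ×ˢ closure O ⊆ e.target
  mem_iff : ∀ x ∈ Metric.closedBall x₀ δ, ∀ y ∈ closure O, e.symm (x, y) ∈ S ↔ y ∈ K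
  separated : HasSeparatedNhds K

omit [NormedSpace ℝ E] [NormedSpace ℝ F] in
theorem HasCantorTransversals.exists_box [ProperSpace F] {S : Set W}
    (h : HasCantorTransversals E F S)
    {p : W} (hp : p ∈ S) {Q : Set W} (hQ : Q ∈ 𝓝 p) :
    ∃ (e : OpenPartialHomeomorph W (E × F)) (δ : ℝ) (O K : Set F), p ∈ e.source ∧ (e p).2 ∈ K ∧
      IsSolenoidBox S e (e p).1 δ O K ∧ e.symm '' (Metric.closedBall (e p).1 δ ×ˢ K) ⊆ Q := by
  obtain ⟨e, he, V, hV, hpV, hVe, ε, hε, K₀, hK₀, hbox⟩ := h p hp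
  obtain ⟨hK₀c, hsep⟩ := hasSeparatedNhds_of_cantor hK₀
  have hpe := hVe hpV
  have hiff : ∀ q ∈ V, q ∈ S ↔ e q ∈ Metric.ball (e p).1 ε ×ˢ K₀ := fun q hq => by
    rw [← hbox]
    refine ⟨fun hS => ⟨q, ⟨hq, hS⟩, rfl⟩, ?_⟩
    rintro ⟨q', ⟨hq', hS'⟩, heq⟩
    rwa [← e.injOn (hVe hq') (hVe hq) heq]
  have hy₀ : (e p).2 ∈ K₀ := ((hiff p hpV).1 hp).2
  have hn : e.target ∩ e.symm ⁻¹' (V ∩ Q) ∈ 𝓝 ((e p).1, (e p).2) := by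
    refine inter_mem (e.open_target.mem_nhds (e.map_source hpe)) ?_
    exact eventually_symm (P := fun q => q ∈ V ∩ Q) hpe (inter_mem (hV.mem_nhds hpV) hQ)
  obtain ⟨A, hA, B, hB, hAB⟩ := mem_nhds_prod_iff.1 hn
  obtain ⟨δ, hδ, hδA⟩ := Metric.nhds_basis_closedBall.mem_iff.1 hA
  obtain ⟨η, hη, hηB⟩ := Metric.nhds_basis_closedBall.mem_iff.1 hB
  obtain ⟨O, hO, hyO, hOη, hcl⟩ := hsep _ hy₀ _ (Metric.closedBall_mem_nhds _ hη)
  have hOη' : closure O ⊆ Metric.closedBall (e p).2 η :=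
    closure_minimal hOη Metric.isClosed_closedBall
  have hδ' : 0 < min δ (ε / 2) := by positivity
  have hsub : Metric.closedBall (e p).1 (min δ (ε / 2)) ×ˢ closure O ⊆
      e.target ∩ e.symm ⁻¹' (V ∩ Q) := fun z hz =>
    hAB ⟨hδA (Metric.closedBall_subset_closedBall (min_le_left _ _) hz.1), hηB (hOη' hz.2)⟩
  -- Separation puts the compact set `K₀ ∩ closure O` inside `O`. The bound `ε / 2` keeps the closed
  -- ball inside the open ball of the flow-box.
  refine ⟨e, min δ (ε / 2), O, K₀ ∩ closure O, hpe, ⟨hy₀, subset_closure hyO⟩,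
    ⟨he, hδ', hO, hK₀c.inter_right isClosed_closure, fun y hy => hcl hy.symm, ?_, ?_, ?_, ?_⟩, ?_⟩
  · exact (isCompact_closedBall _ _).of_isClosed_subset isClosed_closure hOη'
  · exact fun z hz => (hsub hz).1
  · intro x hx y hy
    have hz := hsub (mk_mem_prod hx hy)
    rw [hiff _ hz.2.1, e.right_inv hz.1]
    refine ⟨fun h => ⟨h.2, hy⟩, fun h => ⟨Metric.closedBall_subset_ball ?_ hx, h.1⟩⟩
    exact (min_le_right _ _).trans_lt (half_lt_self hε)
  · exact hsep.mono inter_subset_left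
  · rintro _ ⟨z, hz, rfl⟩
    exact (hsub ⟨hz.1, hz.2.2⟩).2.2

end CantorBoxes

/-! ### Admissible homotopies and the perturbation formula -/

section Step

variable {E F : Type*} [NormedAddCommGroup E] [NormedSpace ℝ E]
  [NormedAddCommGroup F] [NormedSpace ℝ F]
  {W : Type*} [TopologicalSpace W] [ChartedSpace (E × F) W]
  {n d : ℕ} {M : Type*} [TopologicalSpace M] [ChartedSpace (EuclideanSpace ℝ (Fin n)) M]
  {N : Type*} [TopologicalSpace N] [ChartedSpace (EuclideanSpace ℝ (Fin d)) N]
  {r s : ℕ∞}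

omit [NormedSpace ℝ F] in
theorem modelLeafDeriv_congr {f g : W → M} {p : W} (h : f =ᶠ[𝓝 p] g) :
    modelLeafDeriv (E := E) (F := F) (n := n) f p = modelLeafDeriv (E := E) (F := F) g p := by
  have hpc : p ∈ (chartAt (E × F) p).source := mem_chart_source _ _
  exact (slice_eventuallyEq (eventually_symm hpc h :
    (fun z => f ((chartAt (E × F) p).symm z)) =ᶠ[𝓝 (chartAt (E × F) p p)]
      fun z => g ((chartAt (E × F) p).symm z))).mfderiv_eq

omit [NormedSpace ℝ F] in
theorem intersectsTransversally_iff {f : W → M} {S : Set W} {ι : N → M} :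
    IntersectsTransversally E F n d f S ι ↔ ∀ p ∈ S, IntersectsTransversally E F n d f {p} ι := by
  refine ⟨fun h p hp q hq => ?_, fun h p hp => h p hp p rfl⟩
  rw [mem_singleton_iff.1 hq]
  exact h p hp

omit [NormedSpace ℝ F] in
theorem IntersectsTransversally.congr {f g : W → M} {p : W} {ι : N → M} (h : f =ᶠ[𝓝 p] g)
    (hg : IntersectsTransversally E F n d g {p} ι) :
    IntersectsTransversally E F n d f {p} ι := by
  intro q hq z hz
  rw [mem_singleton_iff.1 hq] at hz ⊢
  have h1 := hg p rfl z (by rw [← h.eq_of_nhds, hz])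
  have h2 := modelLeafDeriv_congr (E := E) (F := F) (n := n) h
  change LinearMap.range (modelLeafDeriv (E := E) (F := F) (n := n) f p).toLinearMap ⊔ _ = _
  rw [h2]
  exact h1

variable (E F n d r s) in
/-- `H` is a homotopy of immersions of `S` that starts at `f`, whose graph lies in `𝒪`, and that
ends at a map transverse to `ι` along `T`. -/
structure IsAdmissibleHomotopy (S : Set W) (f : W → M) (ι : N → M) (𝒪 : Set (W × M)) (T : Set W)
    (H : W × ℝ → M) : Prop where
  regular : ∀ p ∈ S, ∀ t ∈ Icc (0 : ℝ) 1, ∀ᶠ q in 𝓝 (p, t), LeafRegularAt (E × ℝ) F n r s H q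
  immersive : ∀ p ∈ S, ∀ t ∈ Icc (0 : ℝ) 1,
    Function.Injective (leafDeriv E F n (fun q => H (q, t)) p)
  mem_graph : ∀ p ∈ S, ∀ t ∈ Icc (0 : ℝ) 1, (p, H (p, t)) ∈ 𝒪
  zero : ∀ p ∈ S, H (p, 0) = f p
  transverse : IntersectsTransversally E F n d (fun q => H (q, 1)) T ι

/-- The leafwise derivative at a point of a homotopy, in charts, is continuous also in time. -/
theorem continuousAt_fderiv_slice_time [IsManifold (𝓡 n) ∞ M] (hr : 1 ≤ r)
    {Θ : OpenPartialHomeomorph M (EuclideanSpace ℝ (Fin n))}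
    (hΘ : Θ ∈ IsManifold.maximalAtlas (𝓡 n) ∞ M)
    {e : OpenPartialHomeomorph W (E × F)} (he : e ∈ atlas (E × F) W) {H : W × ℝ → M} {t : ℝ}
    {z : E × F} (hz : z ∈ e.target) (h : LeafRegularAt (E × ℝ) F n r s H (e.symm z, t))
    (hp : H (e.symm z, t) ∈ Θ.source) :
    ContinuousAt (fun w : ℝ × (E × F) => Θ (H (e.symm w.2, w.1))) (t, z) ∧
    ContinuousAt (fun w : ℝ × (E × F) =>
      fderiv ℝ (fun x => Θ (H (e.symm (x, w.2.2), w.1))) w.2.1) (t, z) := by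
  have hr' : (r : WithTop ℕ∞) ≠ 0 := by
    rintro h
    have : r = 0 := by exact_mod_cast h
    simp [this] at hr
  have h1 := h.chart hΘ hp (e := timeChart e) (mem_atlas_time.2 ⟨e, he, rfl⟩)
    (by simpa using e.map_target hz)
  have hz' : timeChart e (e.symm z, t) = ((z.1, t), z.2) := by simp [e.right_inv hz]
  rw [hz'] at h1
  have hc : ContinuousAt (fun w : ℝ × (E × F) => ((w.2.1, w.1), w.2.2)) (t, z) := by fun_prop
  constructor
  · exact ContinuousAt.comp (f := fun w : ℝ × (E × F) => ((w.2.1, w.1), w.2.2))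
      (x := (t, z)) h1.continuousAt hc
  · have h2 := (h1.continuousAt_fderiv hr).comp (f := fun w : ℝ × (E × F) => ((w.2.1, w.1), w.2.2))
      (x := (t, z)) hc
    -- The derivative in the space direction is the derivative along the leaf `E × ℝ` precomposed
    -- with the inclusion of `E`.
    have h3 := (((ContinuousLinearMap.compL ℝ E (E × ℝ) (EuclideanSpace ℝ (Fin n))).flip
      (ContinuousLinearMap.inl ℝ E ℝ)).continuous.continuousAt).comp h2
    refine h3.congr ?_
    filter_upwards [hc.eventually h1.eventually] with w hw
    have hd : DifferentiableAt ℝ (fun x : E × ℝ => Θ (H ((timeChart e).symm (x, w.2.2))))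
        (w.2.1, w.1) := hw.contDiffAt_slice.differentiableAt hr'
    have hi : HasFDerivAt (fun x : E => (x, w.1)) (ContinuousLinearMap.inl ℝ E ℝ) w.2.1 :=
      hasFDerivAt_prodMk_left _ _
    exact (HasFDerivAt.comp (g := fun x : E × ℝ => Θ (H ((timeChart e).symm (x, w.2.2)))) w.2.1
      hd.hasFDerivAt hi).fderiv.symm

/-- The value, in a chart `Θ`, of the homotopy `H` perturbed by `t φ(x) (g(x) - H(·, 1))`. -/
def perturbedValue (e : OpenPartialHomeomorph W (E × F))
    (Θ : OpenPartialHomeomorph M (EuclideanSpace ℝ (Fin n))) (H : W × ℝ → M) (φ : E → ℝ)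
    (c : F → E → EuclideanSpace ℝ (Fin n)) (q : W × ℝ) : EuclideanSpace ℝ (Fin n) :=
  Θ (H q) + (q.2 * φ (e q.1).1) • (c (e q.1).2 (e q.1).1 - Θ (H (q.1, 1)))

/-- Since `c` is locally constant, near `q` the value is a fixed smooth function of four regular
quantities: `Θ H`, the final stage `Θ H₁` extended constantly in time, the time, and the leaf
coordinate of `e`. -/
theorem contDiffLeafAt_perturbedValue [IsManifold (𝓡 n) ∞ M] (hW : IsFoliatedManifold E F r s W)
    {Θ : OpenPartialHomeomorph M (EuclideanSpace ℝ (Fin n))}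
    (hΘ : Θ ∈ IsManifold.maximalAtlas (𝓡 n) ∞ M)
    {e : OpenPartialHomeomorph W (E × F)} (he : e ∈ atlas (E × F) W) {H : W × ℝ → M}
    {φ : E → ℝ} (hφ : ContDiff ℝ ∞ φ) {c : F → E → EuclideanSpace ℝ (Fin n)} {q : W × ℝ}
    (hq : q.1 ∈ e.source) (hc : ContDiff ℝ ∞ (c (e q.1).2))
    (hcl : ∀ᶠ y in 𝓝 (e q.1).2, c y = c (e q.1).2)
    (hH : LeafRegularAt (E × ℝ) F n r s H q) (hHs : H q ∈ Θ.source)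
    (hH1 : LeafRegularAt (E × ℝ) F n r s H (q.1, 1)) (hH1s : H (q.1, 1) ∈ Θ.source)
    {ê : OpenPartialHomeomorph (W × ℝ) ((E × ℝ) × F)} (hê : ê ∈ atlas ((E × ℝ) × F) (W × ℝ))
    (hqê : q ∈ ê.source) :
    ContDiffLeafAt r s (fun z => perturbedValue e Θ H φ c (ê.symm z)) (ê q) := by
  have h1 := hH.chart hΘ hHs hê hqê
  have h2 := (hH1.stage.extend q.2).chart hΘ hH1s hê hqê
  obtain ⟨e', he', rfl⟩ := mem_atlas_time.1 hê
  have hqe' : q.1 ∈ e'.source := by simpa using hqê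
  have h3 : ContDiffLeafAt r s (fun z : (E × ℝ) × F => z.1.2) (timeChart e' q) :=
    ContDiffLeafAt.of_fst (φ := Prod.snd) (Eventually.of_forall fun x => contDiffAt_snd)
  have h4 : ContDiffLeafAt r s (fun z : (E × ℝ) × F => (e (e'.symm (z.1.1, z.2))).1)
      (timeChart e' q) := by
    have := ContDiffLeafAt.comp_affine (r := r) (s := s) (g := fun z => (e (e'.symm z)).1)
      (ContinuousLinearMap.fst ℝ E ℝ) 0 (z := timeChart e' q)
      (by simpa using contDiffLeafAt_transition_fst hW he' he hqe' hq)
    simpa using this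
  have hΦ : ContDiff ℝ ∞ fun w : ((EuclideanSpace ℝ (Fin n)) × (EuclideanSpace ℝ (Fin n))) ×
      (ℝ × E) => w.1.1 + (w.2.1 * φ w.2.2) • (c (e q.1).2 w.2.2 - w.1.2) := by
    fun_prop
  have h5 := ContDiffLeafAt.comp_left isOpen_univ hΦ.contDiffOn ((h1.prodMk h2).prodMk (h3.prodMk h4))
    (mem_univ _)
  refine h5.congr ?_
  have hcl' : ∀ᶠ q' in 𝓝 q, c (e q'.1).2 = c (e q.1).2 := by
    have : ContinuousAt (fun q' : W × ℝ => (e q'.1).2) q :=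
      (continuousAt_snd.comp (e.continuousAt hq)).comp continuousAt_fst
    exact this.eventually hcl
  filter_upwards [eventually_symm hqê hcl'] with z hz
  simp only [perturbedValue, hz]
  rfl

end Step

/-! ### Choosing the perturbation over a whole box -/

section Family

variable {E F G : Type*} [NormedAddCommGroup E] [NormedSpace ℝ E] [FiniteDimensional ℝ E]
  [NormedAddCommGroup F] [NormedSpace ℝ F]
  [NormedAddCommGroup G] [NormedSpace ℝ G] [FiniteDimensional ℝ G]

/-- The value and derivative of `h + t φ v`, where `h` and `v` have the jets `j` and `k`. -/
def perturbedJet (φ : E → ℝ) (t : ℝ) (x : E) (j k : G × (E →L[ℝ] G)) : G × (E →L[ℝ] G) :=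
  (j.1 + (t * φ x) • k.1, j.2 + t • (φ x • k.2 + (fderiv ℝ φ x).smulRight k.1))

omit [FiniteDimensional ℝ E] [FiniteDimensional ℝ G] in
theorem hasFDerivAt_perturbation {φ : E → ℝ} (hφ : ContDiff ℝ ∞ φ) (t : ℝ) {x : E} {u v : E → G}
    {u' v' : E →L[ℝ] G} (hu : HasFDerivAt u u' x) (hv : HasFDerivAt v v' x) :
    HasFDerivAt (fun y => u y + (t * φ y) • v y)
      (perturbedJet φ t x (u x, u') (v x, v')).2 x := by
  have h1 : HasFDerivAt φ (fderiv ℝ φ x) x := (hφ.differentiable (by simp) x).hasFDerivAt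
  have h2 := hu.add ((h1.smul hv).const_smul t)
  simpa [perturbedJet, mul_smul, Pi.add_def, Pi.smul_def'] using h2

omit [FiniteDimensional ℝ E] [FiniteDimensional ℝ G] in
theorem continuous_perturbedJet {φ : E → ℝ} (hφ : ContDiff ℝ ∞ φ) :
    Continuous fun w : (ℝ × E) × (G × (E →L[ℝ] G)) × (G × (E →L[ℝ] G)) =>
      perturbedJet φ w.1.1 w.1.2 w.2.1 w.2.2 := by
  have h1 : Continuous φ := hφ.continuous
  have h2 : Continuous (fderiv ℝ φ) := hφ.continuous_fderiv (by simp)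
  have h3 : Continuous fun w : (ℝ × E) × (G × (E →L[ℝ] G)) × (G × (E →L[ℝ] G)) =>
      (fderiv ℝ φ w.1.2).smulRight w.2.2.1 := by
    have := (ContinuousLinearMap.smulRightL ℝ E G).continuous₂
    exact this.comp ((h2.comp (by fun_prop : Continuous fun w :
      (ℝ × E) × (G × (E →L[ℝ] G)) × (G × (E →L[ℝ] G)) => w.1.2)).prodMk
      (by fun_prop : Continuous fun w : (ℝ × E) × (G × (E →L[ℝ] G)) × (G × (E →L[ℝ] G)) => w.2.2.1))
  unfold perturbedJet
  fun_prop

-- Here `j` is the leafwise 1-jet of the homotopy, `𝒢` collects the open conditions to keep at all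
-- times, and `𝒯` those to keep at time one. By compactness of the box there is one `η` such that
-- any `c` that is `η`-close in 1-jet to the final stage respects both. Regular approximations
-- within `η` exist on each plaque, and the Cantor structure assembles them.
omit [NormedSpace ℝ F] in
theorem exists_perturbation_family {x₀ : E} {δ : ℝ} {O K : Set F} (hO : IsOpen O) (hKO : K ⊆ O)
    (hK : IsCompact K) (hsep : HasSeparatedNhds K) {j : ℝ × (E × F) → G × (E →L[ℝ] G)}
    (hj : ∀ t ∈ Icc (0 : ℝ) 1, ∀ z ∈ Metric.closedBall x₀ δ ×ˢ K, ContinuousAt j (t, z))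
    (hj1 : ∀ z ∈ Metric.closedBall x₀ δ ×ˢ K, ContDiffAt ℝ 1 (fun x => (j (1, (x, z.2))).1) z.1 ∧
      fderiv ℝ (fun x => (j (1, (x, z.2))).1) z.1 = (j (1, z)).2)
    {𝒢 𝒯 : Set ((E × F) × (G × (E →L[ℝ] G)))} (h𝒢 : IsOpen 𝒢) (h𝒯 : IsOpen 𝒯)
    (hj𝒢 : ∀ t ∈ Icc (0 : ℝ) 1, ∀ z ∈ Metric.closedBall x₀ δ ×ˢ K, (z, j (t, z)) ∈ 𝒢)
    (hj𝒯 : ∀ z ∈ Metric.closedBall x₀ δ ×ˢ K, (z, j (1, z)) ∈ 𝒯)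
    {φ : E → ℝ} (hφ : ContDiff ℝ ∞ φ) {m : ℕ} {π : G →L[ℝ] (Fin m → ℝ)}
    (hπ : Function.Surjective π) :
    ∃ (O' : Set F) (c : F → E → G), IsOpen O' ∧ K ⊆ O' ∧ O' ⊆ O ∧ (∀ y, ContDiff ℝ ∞ (c y)) ∧
      (∀ y ∈ O', ∀ᶠ y' in 𝓝 y, c y' = c y) ∧ ∀ z ∈ Metric.closedBall x₀ δ ×ˢ K,
        (∀ t ∈ Icc (0 : ℝ) 1, (z, perturbedJet φ t z.1 (j (t, z))
          ((c z.2 z.1, fderiv ℝ (c z.2) z.1) - j (1, z))) ∈ 𝒢) ∧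
        (z, perturbedJet φ 1 z.1 (j (1, z))
          ((c z.2 z.1, fderiv ℝ (c z.2) z.1) - j (1, z))) ∈ 𝒯 ∧
        (π (c z.2 z.1) ≠ 0 ∨ Function.Surjective (π.comp (fderiv ℝ (c z.2) z.1))) := by
  have hB : IsCompact (Metric.closedBall x₀ δ) := isCompact_closedBall _ _
  have hpc := continuous_perturbedJet (G := G) hφ
  have hp0 : ∀ t x (a : G × (E →L[ℝ] G)), perturbedJet φ t x a 0 = a := fun t x a => by
    simp [perturbedJet]
  have ev1 : ∀ᶠ k : G × (E →L[ℝ] G) in 𝓝 0, ∀ w ∈ Icc (0 : ℝ) 1 ×ˢ (Metric.closedBall x₀ δ ×ˢ K),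
      (w.2, perturbedJet φ w.1 w.2.1 (j w) k) ∈ 𝒢 := by
    refine (isCompact_Icc.prod (hB.prod hK)).eventually_forall_of_forall_eventually fun w hw => ?_
    have hc : ContinuousAt (fun v : (G × (E →L[ℝ] G)) × (ℝ × (E × F)) =>
        (v.2.2, perturbedJet φ v.2.1 v.2.2.1 (j v.2) v.1)) (0, w) := by
      have hjw : ContinuousAt (fun v : (G × (E →L[ℝ] G)) × (ℝ × (E × F)) => j v.2) (0, w) :=
        (hj w.1 hw.1 w.2 hw.2).comp (f := Prod.snd) (x := ((0 : G × (E →L[ℝ] G)), w))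
          continuousAt_snd
      refine ContinuousAt.prodMk (by fun_prop) ?_
      exact hpc.continuousAt.comp (f := fun v : (G × (E →L[ℝ] G)) × (ℝ × (E × F)) =>
        ((v.2.1, v.2.2.1), (j v.2, v.1))) (x := (0, w))
        (ContinuousAt.prodMk (by fun_prop) (hjw.prodMk continuousAt_fst))
    exact hc.eventually (h𝒢.mem_nhds (by simpa [hp0] using hj𝒢 w.1 hw.1 w.2 hw.2))
  have ev2 : ∀ᶠ k : G × (E →L[ℝ] G) in 𝓝 0, ∀ z ∈ Metric.closedBall x₀ δ ×ˢ K,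
      (z, perturbedJet φ 1 z.1 (j (1, z)) k) ∈ 𝒯 := by
    refine (hB.prod hK).eventually_forall_of_forall_eventually fun z hz => ?_
    have hc : ContinuousAt (fun v : (G × (E →L[ℝ] G)) × (E × F) =>
        (v.2, perturbedJet φ 1 v.2.1 (j (1, v.2)) v.1)) (0, z) := by
      have hjw : ContinuousAt (fun v : (G × (E →L[ℝ] G)) × (E × F) => j (1, v.2)) (0, z) :=
        (hj 1 (by simp) z hz).comp (f := fun v : (G × (E →L[ℝ] G)) × (E × F) => ((1 : ℝ), v.2))
          (x := ((0 : G × (E →L[ℝ] G)), z)) (by fun_prop)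
      refine ContinuousAt.prodMk (by fun_prop) ?_
      exact hpc.continuousAt.comp (f := fun v : (G × (E →L[ℝ] G)) × (E × F) =>
        (((1 : ℝ), v.2.1), (j (1, v.2), v.1))) (x := (0, z))
        (ContinuousAt.prodMk (by fun_prop) (hjw.prodMk continuousAt_fst))
    exact hc.eventually (h𝒯.mem_nhds (by simpa [hp0] using hj𝒯 z hz))
  obtain ⟨η, hη, hball⟩ := Metric.eventually_nhds_iff.1 (ev1.and ev2)
  let R : F → {g : E → G // ContDiff ℝ ∞ g} → Prop := fun y g => ∀ x ∈ Metric.closedBall x₀ δ,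
    dist ((g.1 x, fderiv ℝ g.1 x) - j (1, (x, y))) 0 < η ∧
    (π (g.1 x) ≠ 0 ∨ Function.Surjective (π.comp (fderiv ℝ g.1 x)))
  have hR : ∀ y ∈ K, ∃ g, ∀ᶠ y' in 𝓝 y, y' ∈ K → R y' g := by
    intro y hy
    obtain ⟨g, hg, hgu⟩ := exists_regular_approx_on_compact hπ hB
      (u := fun x => (j (1, (x, y))).1) (fun x hx => (hj1 (x, y) ⟨hx, hy⟩).1) hη
    refine ⟨⟨g, hg⟩, ?_⟩
    -- The map `g` found for the plaque `y` also serves nearby plaques: closeness persists by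
    -- continuity of `j` and compactness of the ball, while regularity of `g` does not involve the
    -- plaque.
    have : ∀ᶠ y' in 𝓝 y, ∀ x ∈ Metric.closedBall x₀ δ,
        dist ((g x, fderiv ℝ g x) - j (1, (x, y'))) 0 < η := by
      refine hB.eventually_forall_of_forall_eventually fun x hx => ?_
      have hg0 : Continuous g := hg.continuous
      have hg1 : Continuous (fderiv ℝ g) := hg.continuous_fderiv (by simp)
      have hjw : ContinuousAt (fun v : F × E => j (1, (v.2, v.1))) (y, x) :=
        (hj 1 (by simp) (x, y) ⟨hx, hy⟩).comp (f := fun v : F × E => ((1 : ℝ), (v.2, v.1)))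
          (x := (y, x)) (by fun_prop)
      have hc : ContinuousAt (fun v : F × E =>
          dist ((g v.2, fderiv ℝ g v.2) - j (1, (v.2, v.1))) 0) (y, x) :=
        (((hg0.prodMk hg1).continuousAt.comp (f := Prod.snd) (x := (y, x))
          continuousAt_snd).sub hjw).dist continuousAt_const
      refine hc.eventually_lt continuousAt_const ?_
      have h1 := hgu x hx
      rw [(hj1 (x, y) ⟨hx, hy⟩).2] at h1
      rw [dist_zero_right, ← dist_eq_norm, Prod.dist_eq]
      exact max_lt h1.1 h1.2.1
    filter_upwards [this] with y' hy' _ x hx using ⟨hy' x hx, (hgu x hx).2.2⟩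
  have : Nonempty {g : E → G // ContDiff ℝ ∞ g} := ⟨⟨fun _ => 0, contDiff_const⟩⟩
  obtain ⟨O', c, hO', hKO', hO'O, hc, hcR⟩ :=
    hsep.exists_locally_constant_choice hK hO hKO hR
  refine ⟨O', fun y => (c y).1, hO', hKO', hO'O, fun y => (c y).2, fun y hy => ?_, fun z hz => ?_⟩
  · filter_upwards [hc y hy] with y' hy' using by rw [hy']
  · obtain ⟨h1, h2⟩ := hcR z.2 hz.2 z.1 hz.1
    have h3 := hball h1
    exact ⟨fun t ht => h3.1 (t, z) ⟨ht, hz⟩, h3.2 z hz, h2⟩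

end Family

/-! ### Achieving transversality on one more box -/

section StepProof

/-- Surjectivity onto `ℝ^m` means rank at least `m`, and rank is lower semicontinuous. -/
theorem isOpen_setOf_surjective {E : Type*} [NormedAddCommGroup E] [NormedSpace ℝ E] (m : ℕ) :
    IsOpen {B : E →L[ℝ] (Fin m → ℝ) | Function.Surjective B} := by
  convert isOpen_setOfPred_nat_le_rank (𝕜 := ℝ) (E := E) (F := Fin m → ℝ) m using 1
  ext B
  change Function.Surjective B.toLinearMap ↔ (m : Cardinal) ≤ LinearMap.rank B.toLinearMap
  rw [← LinearMap.range_eq_top, LinearMap.rank, ← Module.finrank_eq_rank, Nat.cast_le]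
  constructor
  · intro h
    rw [h]; simp
  · intro h
    exact Submodule.eq_top_of_finrank_eq (le_antisymm (Submodule.finrank_le _) (by simpa using h))

variable {E F : Type*} [NormedAddCommGroup E] [NormedSpace ℝ E]
  [NormedAddCommGroup F] [NormedSpace ℝ F]
  {W : Type*} [TopologicalSpace W] [ChartedSpace (E × F) W]
  {n d : ℕ} {M : Type*} [TopologicalSpace M] [ChartedSpace (EuclideanSpace ℝ (Fin n)) M]
  {N : Type*} [TopologicalSpace N] [ChartedSpace (EuclideanSpace ℝ (Fin d)) N]
  {r s : ℕ∞}

theorem continuousAt_perturbedValue [IsManifold (𝓡 n) ∞ M] (hW : IsFoliatedManifold E F r s W)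
    {Θ : OpenPartialHomeomorph M (EuclideanSpace ℝ (Fin n))}
    (hΘ : Θ ∈ IsManifold.maximalAtlas (𝓡 n) ∞ M)
    {e : OpenPartialHomeomorph W (E × F)} (he : e ∈ atlas (E × F) W) {H : W × ℝ → M}
    {φ : E → ℝ} (hφ : ContDiff ℝ ∞ φ) {c : F → E → EuclideanSpace ℝ (Fin n)} {q : W × ℝ}
    (hq : q.1 ∈ e.source) (hc : ContDiff ℝ ∞ (c (e q.1).2))
    (hcl : ∀ᶠ y in 𝓝 (e q.1).2, c y = c (e q.1).2)
    (hH : LeafRegularAt (E × ℝ) F n r s H q) (hHs : H q ∈ Θ.source)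
    (hH1 : LeafRegularAt (E × ℝ) F n r s H (q.1, 1)) (hH1s : H (q.1, 1) ∈ Θ.source) :
    ContinuousAt (perturbedValue e Θ H φ c) q := by
  have hqê : q ∈ (timeChart e).source := by simpa using hq
  have h := (contDiffLeafAt_perturbedValue hW hΘ he hφ hq hc hcl hH hHs hH1 hH1s
    (mem_atlas_time.2 ⟨e, he, rfl⟩) hqê).continuousAt.comp ((timeChart e).continuousAt hqê)
  refine h.congr ?_
  filter_upwards [(timeChart e).open_source.mem_nhds hqê] with q' hq'
  simp only [Function.comp]
  rw [(timeChart e).left_inv hq']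

theorem leafRegularAt_of_perturbedValue [IsManifold (𝓡 n) ∞ M]
    (hW : IsFoliatedManifold E F r s W)
    {Θ : OpenPartialHomeomorph M (EuclideanSpace ℝ (Fin n))}
    (hΘ : Θ ∈ IsManifold.maximalAtlas (𝓡 n) ∞ M)
    {e : OpenPartialHomeomorph W (E × F)} (he : e ∈ atlas (E × F) W) {H H' : W × ℝ → M}
    {φ : E → ℝ} (hφ : ContDiff ℝ ∞ φ) {c : F → E → EuclideanSpace ℝ (Fin n)} {q : W × ℝ}
    (hq : q.1 ∈ e.source) (hc : ContDiff ℝ ∞ (c (e q.1).2))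
    (hcl : ∀ᶠ y in 𝓝 (e q.1).2, c y = c (e q.1).2)
    (hH : LeafRegularAt (E × ℝ) F n r s H q) (hHs : H q ∈ Θ.source)
    (hH1 : LeafRegularAt (E × ℝ) F n r s H (q.1, 1)) (hH1s : H (q.1, 1) ∈ Θ.source)
    (hψ : perturbedValue e Θ H φ c q ∈ Θ.target)
    (hH' : ∀ᶠ q' in 𝓝 q, H' q' = Θ.symm (perturbedValue e Θ H φ c q')) :
    LeafRegularAt (E × ℝ) F n r s H' q := by
  have hψc := continuousAt_perturbedValue hW hΘ he hφ hq hc hcl hH hHs hH1 hH1s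
  have hc' : ContinuousAt H' q :=
    ((Θ.continuousAt_symm hψ).comp hψc).congr (EventuallyEq.symm hH')
  refine leafRegularAt_of_chart hΘ hc' (by rw [hH'.self_of_nhds]; exact Θ.map_target hψ)
    fun ê hê hqê => ?_
  refine (contDiffLeafAt_perturbedValue hW hΘ he hφ hq hc hcl hH hHs hH1 hH1s hê hqê).congr ?_
  have hev : ∀ᶠ q' in 𝓝 q, Θ (H' q') = perturbedValue e Θ H φ c q' := by
    filter_upwards [hH', hψc.eventually (Θ.open_target.mem_nhds hψ)] with q' h1 h2
    rw [h1, Θ.right_inv h2]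
  exact eventually_symm hqê hev

/-- The hypothesis on `𝒪` keeps the homotopy, over the whole box, inside the slice chart, where it
can be perturbed linearly. The gain is on the quarter-size ball; the remaining room is used to cut
the perturbation off. -/
theorem IsAdmissibleHomotopy.step [FiniteDimensional ℝ E] [T2Space W] [IsManifold (𝓡 n) ∞ M]
    (hr : 1 ≤ r) (hW : IsFoliatedManifold E F r s W) {S : Set W} {f : W → M} {ι : N → M}
    {𝒪 : Set (W × M)} {T : Set W} {H : W × ℝ → M}
    (hH : IsAdmissibleHomotopy E F n d r s S f ι 𝒪 T H)
    {e : OpenPartialHomeomorph W (E × F)} {x₀ : E} {δ : ℝ} {O K : Set F}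
    (hbox : IsSolenoidBox S e x₀ δ O K)
    {Θ : OpenPartialHomeomorph M (EuclideanSpace ℝ (Fin n))} {m : ℕ}
    {π : EuclideanSpace ℝ (Fin n) →L[ℝ] (Fin m → ℝ)} (hΘ : IsSliceChart d ι Θ π)
    (h𝒪 : IsOpen 𝒪) (hT : IsClosed T) (hTS : T ⊆ S)
    (h𝒪Θ : ∀ z ∈ Metric.closedBall x₀ δ ×ˢ K, ∀ v, (e.symm z, v) ∈ 𝒪 → v ∈ Θ.source) :
    ∃ H', IsAdmissibleHomotopy E F n d r s S f ι 𝒪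
      (T ∪ e.symm '' (Metric.closedBall x₀ (δ / 4) ×ˢ K)) H' := by
  classical
  have hr' : (r : WithTop ℕ∞) ≠ 0 := by
    rintro h
    have : r = 0 := by exact_mod_cast h
    simp [this] at hr
  have hΘm := hΘ.mem_maximalAtlas
  have he := hbox.mem_atlas
  have hδ := hbox.pos
  have one_mem : (1 : ℝ) ∈ Icc (0 : ℝ) 1 := by simp
  have hKcl : K ⊆ closure O := hbox.subset.trans subset_closure
  have htgt : ∀ z ∈ Metric.closedBall x₀ δ ×ˢ K, z ∈ e.target := fun z hz =>
    hbox.subset_target ⟨hz.1, hKcl hz.2⟩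
  have hmemS : ∀ z ∈ Metric.closedBall x₀ δ ×ˢ K, e.symm z ∈ S := fun z hz =>
    (hbox.mem_iff z.1 hz.1 z.2 (hKcl hz.2)).2 hz.2
  have hsrc : ∀ t ∈ Icc (0 : ℝ) 1, ∀ z ∈ Metric.closedBall x₀ δ ×ˢ K,
      H (e.symm z, t) ∈ Θ.source := fun t ht z hz =>
    h𝒪Θ z hz _ (hH.mem_graph _ (hmemS z hz) t ht)
  have hreg : ∀ t ∈ Icc (0 : ℝ) 1, ∀ z ∈ Metric.closedBall x₀ δ ×ˢ K,
      LeafRegularAt (E × ℝ) F n r s H (e.symm z, t) := fun t ht z hz =>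
    (hH.regular _ (hmemS z hz) t ht).self_of_nhds
  have hslice : ∀ t ∈ Icc (0 : ℝ) 1, ∀ z ∈ Metric.closedBall x₀ δ ×ˢ K,
      ContDiffAt ℝ r (fun x => Θ (H (e.symm (x, z.2), t))) z.1 := fun t ht z hz => by
    have := ((hreg t ht z hz).stage.chart hΘm (hsrc t ht z hz) he
      (e.map_target (htgt z hz))).contDiffAt_slice
    rwa [e.right_inv (htgt z hz)] at this
  let j : ℝ × (E × F) → EuclideanSpace ℝ (Fin n) × (E →L[ℝ] EuclideanSpace ℝ (Fin n)) := fun w =>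
    (Θ (H (e.symm w.2, w.1)), fderiv ℝ (fun x => Θ (H (e.symm (x, w.2.2), w.1))) w.2.1)
  let 𝒢 : Set ((E × F) × (EuclideanSpace ℝ (Fin n) × (E →L[ℝ] EuclideanSpace ℝ (Fin n)))) :=
    {w | w.1 ∈ e.target ∧ w.2.1 ∈ Θ.target ∧ (e.symm w.1, Θ.symm w.2.1) ∈ 𝒪 ∧
      Function.Injective w.2.2}
  -- Transversality is requested only over `T`. Closedness of `T` makes this conditional requirement
  -- open.
  let 𝒯 : Set ((E × F) × (EuclideanSpace ℝ (Fin n) × (E →L[ℝ] EuclideanSpace ℝ (Fin n)))) :=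
    {w | w.1 ∈ e.target ∧ (e.symm w.1 ∈ T → π w.2.1 ≠ 0 ∨ Function.Surjective (π.comp w.2.2))}
  have h𝒢 : IsOpen 𝒢 := by
    have hA : IsOpen (e.target ×ˢ (Θ.target ×ˢ (univ : Set (E →L[ℝ] EuclideanSpace ℝ (Fin n))))) :=
      e.open_target.prod (Θ.open_target.prod isOpen_univ)
    have hf : ContinuousOn (fun w : (E × F) × (EuclideanSpace ℝ (Fin n) ×
        (E →L[ℝ] EuclideanSpace ℝ (Fin n))) => (e.symm w.1, Θ.symm w.2.1))
        (e.target ×ˢ (Θ.target ×ˢ univ)) :=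
      (e.continuousOn_symm.comp continuousOn_fst fun w hw => hw.1).prodMk
        (Θ.continuousOn_symm.comp (by fun_prop) fun w hw => hw.2.1)
    have h1 := (hf.isOpen_inter_preimage hA h𝒪).inter
      (ContinuousLinearMap.isOpen_injective.preimage (f := fun w : (E × F) ×
        (EuclideanSpace ℝ (Fin n) × (E →L[ℝ] EuclideanSpace ℝ (Fin n))) => w.2.2) (by fun_prop))
    convert h1 using 1
    ext w
    simp only [𝒢, mem_inter_iff, mem_prod, mem_preimage, mem_univ, and_true, mem_ofPred_eq]
    tauto
  have h𝒯 : IsOpen 𝒯 := by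
    have h1 : IsOpen ((e.target ∩ e.symm ⁻¹' Tᶜ) ×ˢ
        (univ : Set (EuclideanSpace ℝ (Fin n) × (E →L[ℝ] EuclideanSpace ℝ (Fin n))))) :=
      (e.symm.isOpen_inter_preimage hT.isOpen_compl).prod isOpen_univ
    have h2 : IsOpen {w : EuclideanSpace ℝ (Fin n) × (E →L[ℝ] EuclideanSpace ℝ (Fin n)) |
        π w.1 ≠ 0 ∨ Function.Surjective (π.comp w.2)} := by
      refine IsOpen.union ?_ ?_
      · exact isOpen_ne_fun (by fun_prop) continuous_const
      · exact (isOpen_setOf_surjective m).preimage (f := fun w : EuclideanSpace ℝ (Fin n) ×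
          (E →L[ℝ] EuclideanSpace ℝ (Fin n)) => π.comp w.2) (by fun_prop)
    convert h1.union (e.open_target.prod h2) using 1
    ext w
    simp only [𝒯, mem_union, mem_inter_iff, mem_prod, mem_preimage, mem_univ, and_true,
      mem_ofPred_eq, mem_compl_iff]
    tauto
  have hslice1 : ∀ t ∈ Icc (0 : ℝ) 1, ∀ z ∈ Metric.closedBall x₀ δ ×ˢ K,
      fderiv ℝ (fun x => Θ (H (e.symm (x, (e (e.symm z)).2), t))) (e (e.symm z)).1 =
        (j (t, z)).2 := fun t ht z hz => by rw [e.right_inv (htgt z hz)]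
  -- The bump is `1` on a neighbourhood of the ball of radius `δ / 4`, so that derivatives there are
  -- those of `c`. It vanishes from distance `3 * δ / 4` on, inside the box.
  let β : ContDiffBump x₀ := ⟨δ / 2, 3 * δ / 4, by positivity, by linarith⟩
  have hφ : ContDiff ℝ ∞ β := β.contDiff
  obtain ⟨O', c, hO', hKO', hO'O, hc, hcl, hfam⟩ := exists_perturbation_family hbox.isOpen
    hbox.subset hbox.isCompact hbox.separated (x₀ := x₀) (δ := δ) (j := j)
    (fun t ht z hz => by
      have := continuousAt_fderiv_slice_time hr hΘm he (htgt z hz) (hreg t ht z hz) (hsrc t ht z hz)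
      exact this.1.prodMk this.2)
    (fun z hz => ⟨(hslice 1 one_mem z hz).of_le (by exact_mod_cast hr), rfl⟩) h𝒢 h𝒯
    (fun t ht z hz => ⟨htgt z hz, Θ.map_source (hsrc t ht z hz), by
        rw [Θ.left_inv (hsrc t ht z hz)]
        exact hH.mem_graph _ (hmemS z hz) t ht, by
        have := (injective_leafDeriv_iff hr hW hΘm (hreg t ht z hz).stage (hsrc t ht z hz) he
          (e.map_target (htgt z hz))).1 (hH.immersive _ (hmemS z hz) t ht)
        rwa [hslice1 t ht z hz] at this⟩)
    (fun z hz => ⟨htgt z hz, fun hzT => by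
        have := (hΘ.transversal_iff hr hW (hreg 1 one_mem z hz).stage (hsrc 1 one_mem z hz) he
          (e.map_target (htgt z hz))).1 (intersectsTransversally_iff.1 hH.transverse _ hzT)
        rwa [hslice1 1 one_mem z hz] at this⟩)
    hφ hΘ.surjective
  let Z : Set W := e.symm '' (Metric.closedBall x₀ (3 * δ / 4) ×ˢ closure O)
  have hball : Metric.closedBall x₀ (3 * δ / 4) ⊆ Metric.closedBall x₀ δ :=
    Metric.closedBall_subset_closedBall (by linarith)
  have hZ : IsClosed Z :=
    (((isCompact_closedBall _ _).prod hbox.isCompact_closure).image_of_continuousOn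
      (e.continuousOn_symm.mono fun z hz => hbox.subset_target ⟨hball hz.1, hz.2⟩)).isClosed
  let ψ := perturbedValue e Θ H β c
  -- `H'` may jump across the transverse boundary of `Z`. This is harmless, since points of `S` in
  -- `Z` have transverse coordinate in `K`, which lies inside the open set `O'`.
  let H' : W × ℝ → M := fun q => if q.1 ∈ Z then Θ.symm (ψ q) else H q
  have hZS : ∀ p ∈ S, p ∈ Z → ∃ z ∈ Metric.closedBall x₀ (3 * δ / 4) ×ˢ K, e.symm z = p := by
    rintro p hp ⟨z, hz, rfl⟩
    exact ⟨z, ⟨hz.1, (hbox.mem_iff z.1 (hball hz.1) z.2 hz.2).1 hp⟩, rfl⟩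
  have hoff : ∀ p, p ∉ Z → ∀ t, ∀ᶠ q in 𝓝 (p, t), H' q = H q := fun p hp t => by
    have : ∀ᶠ q : W × ℝ in 𝓝 (p, t), q.1 ∈ Zᶜ :=
      continuousAt_fst.eventually (hZ.isOpen_compl.mem_nhds hp)
    filter_upwards [this] with q hq using if_neg hq
  -- Over `O'`, a point can leave `Z` only through the leaf direction, where the cut-off is zero and
  -- both branches agree.
  have hformula : ∀ q : W × ℝ, q.1 ∈ e.source → e q.1 ∈ Metric.ball x₀ δ ×ˢ O' →
      H q ∈ Θ.source → H' q = Θ.symm (ψ q) := by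
    intro q hq hq' hqs
    by_cases hqZ : q.1 ∈ Z
    · exact if_pos hqZ
    · have h0 : β (e q.1).1 = 0 := by
        refine β.zero_of_le_dist (le_of_not_ge fun h => hqZ ?_)
        exact ⟨e q.1, ⟨h, subset_closure (hO'O hq'.2)⟩, e.left_inv hq⟩
      have h1 : ψ q = Θ (H q) := by simp [ψ, perturbedValue, h0]
      rw [h1, Θ.left_inv hqs]
      exact if_neg hqZ
  have hψjet : ∀ t, ∀ z ∈ Metric.closedBall x₀ δ ×ˢ K, ψ (e.symm z, t) =
      (perturbedJet β t z.1 (j (t, z))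
        ((c z.2 z.1, fderiv ℝ (c z.2) z.1) - j (1, z))).1 := fun t z hz => by
    simp only [ψ, perturbedValue, perturbedJet, j, e.right_inv (htgt z hz), Prod.fst_sub]
  have hnear : ∀ t ∈ Icc (0 : ℝ) 1, ∀ z ∈ Metric.closedBall x₀ (3 * δ / 4) ×ˢ K,
      ∀ᶠ q in 𝓝 (e.symm z, t), (q.1 ∈ e.source ∧ e q.1 ∈ Metric.ball x₀ δ ×ˢ O' ∧
        H q ∈ Θ.source ∧ H (q.1, 1) ∈ Θ.source ∧ LeafRegularAt (E × ℝ) F n r s H q ∧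
        LeafRegularAt (E × ℝ) F n r s H (q.1, 1)) ∧ ψ q ∈ Θ.target := by
    intro t ht z hz
    have hz' : z ∈ Metric.closedBall x₀ δ ×ˢ K := ⟨hball hz.1, hz.2⟩
    have hs : e.symm z ∈ e.source := e.map_target (htgt z hz')
    have hez : e (e.symm z) = z := e.right_inv (htgt z hz')
    have c1 : ContinuousAt (fun q : W × ℝ => q.1) (e.symm z, t) := continuousAt_fst
    have c2 : ContinuousAt (fun q : W × ℝ => e q.1) (e.symm z, t) := 
      ContinuousAt.comp (g := e) (f := fun q : W × ℝ => q.1) (x := (e.symm z, t))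
        (e.continuousAt hs) c1
    have c3 : ContinuousAt (fun q : W × ℝ => (q.1, (1 : ℝ))) (e.symm z, t) := by fun_prop
    have c4 : ContinuousAt (fun q : W × ℝ => H (q.1, 1)) (e.symm z, t) :=
      (hreg 1 one_mem z hz').1.comp (f := fun q : W × ℝ => (q.1, (1 : ℝ))) c3
    have c5 := continuousAt_perturbedValue hW hΘm he hφ (q := (e.symm z, t)) hs (hc _)
      (by rw [hez]; exact hcl _ (hKO' hz.2)) (hreg t ht z hz') (hsrc t ht z hz')
      (hreg 1 one_mem z hz') (hsrc 1 one_mem z hz')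
    have hb : Metric.ball x₀ δ ×ˢ O' ∈ 𝓝 (e (e.symm z)) := by
      rw [hez]
      refine (Metric.isOpen_ball.prod hO').mem_nhds ⟨?_, hKO' hz.2⟩
      exact Metric.closedBall_subset_ball (by linarith) hz.1
    have ht : ψ (e.symm z, t) ∈ Θ.target := by
      rw [hψjet t z hz']
      exact ((hfam z hz').1 t ht).2.1
    filter_upwards [c1.eventually (e.open_source.mem_nhds hs), c2.eventually hb,
      (hreg t ‹_› z hz').1.eventually (Θ.open_source.mem_nhds (hsrc t ‹_› z hz')),
      c4.eventually (Θ.open_source.mem_nhds (hsrc 1 one_mem z hz')),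
      hH.regular _ (hmemS z hz') t ‹_›, c3.eventually (hH.regular _ (hmemS z hz') 1 one_mem),
      c5.eventually (Θ.open_target.mem_nhds ht)] with q h1 h2 h3 h4 h5 h6 h7
    exact ⟨⟨h1, h2, h3, h4, h5, h6⟩, h7⟩
  have hregZ : ∀ t ∈ Icc (0 : ℝ) 1, ∀ z ∈ Metric.closedBall x₀ (3 * δ / 4) ×ˢ K,
      ∀ᶠ q in 𝓝 (e.symm z, t), LeafRegularAt (E × ℝ) F n r s H' q := by
    intro t ht z hz
    filter_upwards [(hnear t ht z hz).eventually_nhds] with q hq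
    obtain ⟨⟨h1, h2, h3, h4, h5, h6⟩, h7⟩ := hq.self_of_nhds
    refine leafRegularAt_of_perturbedValue hW hΘm he hφ h1 (hc _) (hcl _ h2.2) h5 h3 h6 h4 h7 ?_
    filter_upwards [hq] with q' hq' using hformula q' hq'.1.1 hq'.1.2.1 hq'.1.2.2.1
  have hderZ : ∀ t ∈ Icc (0 : ℝ) 1, ∀ z ∈ Metric.closedBall x₀ (3 * δ / 4) ×ˢ K,
      Θ (H' (e.symm z, t)) = (perturbedJet β t z.1 (j (t, z))
        ((c z.2 z.1, fderiv ℝ (c z.2) z.1) - j (1, z))).1 ∧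
      (fun x => Θ (H' (e.symm (x, z.2), t))) =ᶠ[𝓝 z.1] (fun x => Θ (H (e.symm (x, z.2), t)) +
        (t * β x) • (c z.2 x - Θ (H (e.symm (x, z.2), 1)))) ∧
      fderiv ℝ (fun x => Θ (H' (e.symm (x, z.2), t))) z.1 = (perturbedJet β t z.1 (j (t, z))
        ((c z.2 z.1, fderiv ℝ (c z.2) z.1) - j (1, z))).2 := by
    intro t ht z hz
    have hz' : z ∈ Metric.closedBall x₀ δ ×ˢ K := ⟨hball hz.1, hz.2⟩
    have hzt := htgt z hz'
    have hval : ∀ᶠ q in 𝓝 (e.symm z, t), Θ (H' q) = ψ q := by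
      filter_upwards [hnear t ht z hz] with q hq
      rw [hformula q hq.1.1 hq.1.2.1 hq.1.2.2.1, Θ.right_inv hq.2]
    have hcs : ContinuousAt (fun x => (x, z.2)) z.1 := by fun_prop
    have hct : ContinuousAt (fun x => (e.symm (x, z.2), t)) z.1 :=
      ((e.continuousAt_symm hzt).comp (f := fun x => (x, z.2)) hcs).prodMk continuousAt_const
    have heq : (fun x => Θ (H' (e.symm (x, z.2), t))) =ᶠ[𝓝 z.1]
        (fun x => Θ (H (e.symm (x, z.2), t)) +
        (t * β x) • (c z.2 x - Θ (H (e.symm (x, z.2), 1)))) := by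
      filter_upwards [hct.eventually hval, hcs.eventually (e.open_target.mem_nhds hzt)] with x h1 h2
      simp only [h1, ψ, perturbedValue]
      rw [e.right_inv h2]
    refine ⟨by rw [hval.self_of_nhds, hψjet t z hz'], heq, ?_⟩
    rw [heq.fderiv_eq]
    exact (hasFDerivAt_perturbation hφ t ((hslice t ht z hz').differentiableAt hr').hasFDerivAt
      (((hc z.2).differentiable (by simp) z.1).hasFDerivAt.sub
        ((hslice 1 one_mem z hz').differentiableAt hr').hasFDerivAt)).fderiv
  have hsrcZ : ∀ t ∈ Icc (0 : ℝ) 1, ∀ z ∈ Metric.closedBall x₀ (3 * δ / 4) ×ˢ K,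
      H' (e.symm z, t) ∈ Θ.source := by
    intro t ht z hz
    obtain ⟨⟨h1, h2, h3, h4, h5, h6⟩, h7⟩ := (hnear t ht z hz).self_of_nhds
    rw [hformula _ h1 h2 h3]
    exact Θ.map_target h7
  have hsliceZ : ∀ t ∈ Icc (0 : ℝ) 1, ∀ z ∈ Metric.closedBall x₀ (3 * δ / 4) ×ˢ K,
      fderiv ℝ (fun x => Θ (H' (e.symm (x, (e (e.symm z)).2), t))) (e (e.symm z)).1 =
        (perturbedJet β t z.1 (j (t, z)) ((c z.2 z.1, fderiv ℝ (c z.2) z.1) - j (1, z))).2 :=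
    fun t ht z hz => by
      rw [e.right_inv (htgt z ⟨hball hz.1, hz.2⟩), (hderZ t ht z hz).2.2]
  refine ⟨H', ?_, ?_, ?_, ?_, ?_⟩
  · intro p hp t ht
    by_cases hpZ : p ∈ Z
    · obtain ⟨z, hz, rfl⟩ := hZS p hp hpZ
      exact hregZ t ht z hz
    · filter_upwards [(hoff p hpZ t).eventually_nhds, hH.regular p hp t ht] with q h1 h2
      exact h2.congr h1
  · intro p hp t ht
    by_cases hpZ : p ∈ Z
    · obtain ⟨z, hz, rfl⟩ := hZS p hp hpZ
      have hz' : z ∈ Metric.closedBall x₀ δ ×ˢ K := ⟨hball hz.1, hz.2⟩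
      rw [injective_leafDeriv_iff hr hW hΘm ((hregZ t ht z hz).self_of_nhds).stage
        (hsrcZ t ht z hz) he (e.map_target (htgt z hz')), hsliceZ t ht z hz]
      exact ((hfam z hz').1 t ht).2.2.2
    · have hcg : (fun q => H' (q, t)) =ᶠ[𝓝 p] fun q => H (q, t) := by
        have hct : ContinuousAt (fun q : W => (q, t)) p := by fun_prop
        exact hct.eventually (hoff p hpZ t)
      change Function.Injective (modelLeafDeriv (E := E) (F := F) (n := n) (fun q => H' (q, t)) p)
      rw [modelLeafDeriv_congr hcg]
      exact hH.immersive p hp t ht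
  · intro p hp t ht
    by_cases hpZ : p ∈ Z
    · obtain ⟨z, hz, rfl⟩ := hZS p hp hpZ
      have hz' : z ∈ Metric.closedBall x₀ δ ×ˢ K := ⟨hball hz.1, hz.2⟩
      have := ((hfam z hz').1 t ht).2.2.1
      rwa [← (hderZ t ht z hz).1, Θ.left_inv (hsrcZ t ht z hz)] at this
    · rw [(hoff p hpZ t).self_of_nhds]
      exact hH.mem_graph p hp t ht
  · intro p hp
    rw [← hH.zero p hp]
    by_cases hpZ : p ∈ Z
    · obtain ⟨z, hz, rfl⟩ := hZS p hp hpZ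
      have hz' : z ∈ Metric.closedBall x₀ δ ×ˢ K := ⟨hball hz.1, hz.2⟩
      have h1 : ψ (e.symm z, 0) = Θ (H (e.symm z, 0)) := by simp [ψ, perturbedValue]
      calc H' (e.symm z, 0) = Θ.symm (ψ (e.symm z, 0)) := if_pos hpZ
        _ = H (e.symm z, 0) := by rw [h1, Θ.left_inv (hsrc 0 (by simp) z hz')]
    · exact (hoff p hpZ 0).self_of_nhds
  · rw [intersectsTransversally_iff]
    have htrans : ∀ z ∈ Metric.closedBall x₀ (3 * δ / 4) ×ˢ K,
        (IntersectsTransversally E F n d (fun q => H' (q, 1)) {e.symm z} ι ↔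
          π (Θ (H' (e.symm z, 1))) ≠ 0 ∨ Function.Surjective (π.comp
            (fderiv ℝ (fun x => Θ (H' (e.symm (x, z.2), 1))) z.1))) := fun z hz => by
      have hz' : z ∈ Metric.closedBall x₀ δ ×ˢ K := ⟨hball hz.1, hz.2⟩
      rw [hΘ.transversal_iff hr hW ((hregZ 1 one_mem z hz).self_of_nhds).stage
        (hsrcZ 1 one_mem z hz) he (e.map_target (htgt z hz')), e.right_inv (htgt z hz')]
    rintro p (hp | ⟨z, hz, rfl⟩)
    · by_cases hpZ : p ∈ Z
      · obtain ⟨z, hz, rfl⟩ := hZS p (hTS hp) hpZ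
        have hz' : z ∈ Metric.closedBall x₀ δ ×ˢ K := ⟨hball hz.1, hz.2⟩
        rw [htrans z hz, (hderZ 1 one_mem z hz).1, (hderZ 1 one_mem z hz).2.2]
        exact (hfam z hz').2.1.2 hp
      · have hcg : (fun q => H' (q, 1)) =ᶠ[𝓝 p] fun q => H (q, 1) := by
          have hct : ContinuousAt (fun q : W => (q, (1 : ℝ))) p := by fun_prop
          exact hct.eventually (hoff p hpZ 1)
        exact (intersectsTransversally_iff.1 hH.transverse p hp).congr hcg
    · have hz1 : z ∈ Metric.closedBall x₀ (3 * δ / 4) ×ˢ K :=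
        ⟨Metric.closedBall_subset_closedBall (by linarith) hz.1, hz.2⟩
      have hz' : z ∈ Metric.closedBall x₀ δ ×ˢ K := ⟨hball hz1.1, hz.2⟩
      -- At time one and with cut-off one, the old map cancels and only the regular map `c z.2` is
      -- left.
      have heq : (fun x => Θ (H' (e.symm (x, z.2), 1))) =ᶠ[𝓝 z.1] c z.2 := by
        have hb1 : z.1 ∈ Metric.ball x₀ (δ / 2) :=
          Metric.closedBall_subset_ball (by linarith) hz.1
        filter_upwards [(hderZ 1 one_mem z hz1).2.1, β.eventuallyEq_one_of_mem_ball hb1]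
          with x h1 h2
        rw [h1, h2]
        simp
      rw [htrans z hz1, heq.fderiv_eq]
      have hv : Θ (H' (e.symm z, 1)) = c z.2 z.1 := heq.eq_of_nhds
      rw [hv]
      exact (hfam z hz').2.2

end StepProof

/-! ### Finite covering and conclusion -/

section Final

variable {E F : Type*} [NormedAddCommGroup E] [NormedSpace ℝ E]
  [NormedAddCommGroup F] [NormedSpace ℝ F]
  {W : Type*} [TopologicalSpace W] [ChartedSpace (E × F) W]
  {n d : ℕ} {M : Type*} [TopologicalSpace M] [ChartedSpace (EuclideanSpace ℝ (Fin n)) M]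
  {N : Type*} [TopologicalSpace N] [ChartedSpace (EuclideanSpace ℝ (Fin d)) N]
  {r s : ℕ∞}

-- Saturation by leaves is used here: a small ball in the plaque through `p` is connected, so it
-- stays in the leaf. Hence leafwise differentials at points of `S` depend only on values on `S`.
omit [NormedSpace ℝ F] in
theorem IsPreSolenoid.eventually_slice_mem {S : Set W} (hS : IsPreSolenoid E F S) {p : W}
    (hp : p ∈ S) : ∀ᶠ x in 𝓝 (chartAt (E × F) p p).1,
      (chartAt (E × F) p).symm (x, (chartAt (E × F) p p).2) ∈ S := by
  set e := chartAt (E × F) p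
  have hpe : p ∈ e.source := mem_chart_source _ _
  have hc : ContinuousAt (fun x : E => (x, (e p).2)) (e p).1 := by fun_prop
  obtain ⟨ε, hε, hball⟩ := Metric.mem_nhds_iff.1
    (hc.preimage_mem_nhds (e.open_target.mem_nhds (e.map_source hpe)))
  filter_upwards [Metric.ball_mem_nhds _ hε] with x hx
  refine hS.2 p hp (Relation.ReflTransGen.single ⟨e, chart_mem_atlas _ _, hpe,
    e.map_target (hball hx), ?_⟩)
  rw [e.right_inv (hball hx)]
  have h1 : JoinedIn (Metric.ball (e p).1 ε) (e p).1 x :=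
    ((convex_ball (e p).1 ε).isPathConnected ⟨_, Metric.mem_ball_self hε⟩).joinedIn _
      (Metric.mem_ball_self hε) _ hx
  obtain ⟨γ, hγ⟩ := h1
  exact ⟨γ.map (f := fun x : E => (x, (e p).2)) (by fun_prop), fun a => ⟨hball (hγ a), rfl⟩⟩

omit [NormedSpace ℝ F] in
theorem IsPreSolenoid.injective_leafDeriv_congr {S : Set W} (hS : IsPreSolenoid E F S)
    {f g : W → M} (h : EqOn g f S) {p : W} (hp : p ∈ S)
    (hf : Function.Injective (leafDeriv E F n f p)) :
    Function.Injective (leafDeriv E F n g p) := by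
  have h1 : modelLeafDeriv (E := E) (F := F) (n := n) g p =
      modelLeafDeriv (E := E) (F := F) (n := n) f p :=
    EventuallyEq.mfderiv_eq ((hS.eventually_slice_mem hp).mono fun x hx => h hx)
  change Function.Injective (modelLeafDeriv (E := E) (F := F) (n := n) g p)
  rw [h1]
  exact hf

omit [NormedSpace ℝ E] [NormedSpace ℝ F] in
theorem IsSolenoidBox.image_mem_nhdsWithin {S : Set W} {e : OpenPartialHomeomorph W (E × F)}
    {p : W} {δ : ℝ} {O K : Set F} (h : IsSolenoidBox S e (e p).1 δ O K) (hp : p ∈ e.source)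
    (hpK : (e p).2 ∈ K) {δ' : ℝ} (hδ' : 0 < δ') (hδ : δ' ≤ δ) :
    e.symm '' (Metric.closedBall (e p).1 δ' ×ˢ K) ∈ 𝓝[S] p := by
  have h1 : e ⁻¹' (Metric.closedBall (e p).1 δ' ×ˢ O) ∈ 𝓝 p :=
    (e.continuousAt hp).preimage_mem_nhds (prod_mem_nhds (Metric.closedBall_mem_nhds _ hδ')
      (h.isOpen.mem_nhds (h.subset hpK)))
  filter_upwards [mem_nhdsWithin_of_mem_nhds h1, self_mem_nhdsWithin,
    mem_nhdsWithin_of_mem_nhds (e.open_source.mem_nhds hp)] with q hq hqS hqe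
  refine ⟨e q, ⟨hq.1, (h.mem_iff _ (Metric.closedBall_subset_closedBall hδ hq.1) _
    (subset_closure hq.2)).1 ?_⟩, e.left_inv hqe⟩
  rwa [Prod.mk.eta, e.left_inv hqe]

omit [NormedSpace ℝ E] [NormedSpace ℝ F] in
theorem IsSolenoidBox.image_subset {S : Set W} {e : OpenPartialHomeomorph W (E × F)}
    {x₀ : E} {δ : ℝ} {O K : Set F} (h : IsSolenoidBox S e x₀ δ O K) :
    e.symm '' (Metric.closedBall x₀ δ ×ˢ K) ⊆ S := by
  rintro _ ⟨z, hz, rfl⟩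
  exact (h.mem_iff z.1 hz.1 z.2 (subset_closure (h.subset hz.2))).2 hz.2

omit [NormedSpace ℝ E] [NormedSpace ℝ F] in
theorem IsSolenoidBox.isCompact_image [ProperSpace E] {S : Set W}
    {e : OpenPartialHomeomorph W (E × F)} {x₀ : E} {δ δ' : ℝ} {O K : Set F}
    (h : IsSolenoidBox S e x₀ δ O K) (hδ : δ' ≤ δ) :
    IsCompact (e.symm '' (Metric.closedBall x₀ δ' ×ˢ K)) :=
  ((isCompact_closedBall _ _).prod h.isCompact).image_of_continuousOn <|
    e.continuousOn_symm.mono ((Set.prod_mono (Metric.closedBall_subset_closedBall hδ)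
      (h.subset.trans subset_closure)).trans h.subset_target)

theorem isOpen_setOf_imp_mem {X Y : Type*} [TopologicalSpace X] [TopologicalSpace Y] {B : Set X}
    {V : Set Y} (hB : IsClosed B) (hV : IsOpen V) :
    IsOpen {z : X × Y | z.1 ∈ B → z.2 ∈ V} := by
  have : {z : X × Y | z.1 ∈ B → z.2 ∈ V} = Prod.fst ⁻¹' Bᶜ ∪ Prod.snd ⁻¹' V := by
    ext z
    simp [imp_iff_not_or]
  rw [this]
  exact (hB.isOpen_compl.preimage continuous_fst).union (hV.preimage continuous_snd)

/-- Near each point of a solenoid, homotopies of immersions that stay close to the initial map can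
be made transverse. -/
theorem exists_local_step [FiniteDimensional ℝ E] [FiniteDimensional ℝ F] [T2Space W]
    [IsManifold (𝓡 n) ∞ M] [IsManifold (𝓡 d) ∞ N] (hr : 1 ≤ r)
    (hW : IsFoliatedManifold E F r s W) {S : Set W}
    (hcantor : HasCantorTransversals E F S) {f : W → M} {ι : N → M}
    (hι : IsSmoothEmbedding (𝓡 d) (𝓡 n) ∞ ι) (hclosed : IsClosed (range ι)) {p : W} (hp : p ∈ S)
    (hf : ContinuousAt f p) :
    ∃ (𝒪 : Set (W × M)) (C : Set W), IsOpen 𝒪 ∧ IsClosed C ∧ C ⊆ S ∧ C ∈ 𝓝[S] p ∧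
      (∀ q, (q, f q) ∈ 𝒪) ∧ ∀ 𝒪', IsOpen 𝒪' → 𝒪' ⊆ 𝒪 → ∀ T, IsClosed T → T ⊆ S →
        ∀ H, IsAdmissibleHomotopy E F n d r s S f ι 𝒪' T H →
          ∃ H', IsAdmissibleHomotopy E F n d r s S f ι 𝒪' (T ∪ C) H' := by
  have : ProperSpace E := FiniteDimensional.proper_real E
  have : ProperSpace F := FiniteDimensional.proper_real F
  -- If `f p` is off the closed range of `ι`, then `𝒪` can force a whole box to stay off it.
  -- Transversality there is vacuous and the homotopy is left alone.
  by_cases hfp : f p ∈ range ι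
  · obtain ⟨z, hz⟩ := hfp
    obtain ⟨c, Θ, π, hzΘ, hΘ⟩ := exists_isSliceChart hι z
    rw [hz] at hzΘ
    obtain ⟨e, δ, O, K, hpe, hpK, hbox, hQ⟩ := hcantor.exists_box hp
      (hf.preimage_mem_nhds (Θ.open_source.mem_nhds hzΘ))
    have hδ := hbox.pos
    refine ⟨_, e.symm '' (Metric.closedBall (e p).1 (δ / 4) ×ˢ K),
      isOpen_setOf_imp_mem (hbox.isCompact_image le_rfl).isClosed Θ.open_source,
      (hbox.isCompact_image (by linarith)).isClosed,
      (image_mono (prod_mono_left (Metric.closedBall_subset_closedBall (by linarith)))).trans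
        hbox.image_subset,
      hbox.image_mem_nhdsWithin hpe hpK (by linarith) (by linarith),
      fun q hq => hQ hq, fun 𝒪' h𝒪' hsub T hT hTS H hH => ?_⟩
    exact hH.step hr hW hbox hΘ h𝒪' hT hTS fun z hz v hv => hsub hv ⟨z, hz, rfl⟩
  · obtain ⟨e, δ, O, K, hpe, hpK, hbox, hQ⟩ := hcantor.exists_box hp
      (hf.preimage_mem_nhds (hclosed.isOpen_compl.mem_nhds hfp))
    have hB := hbox.isCompact_image (le_refl δ)
    refine ⟨_, _, isOpen_setOf_imp_mem hB.isClosed hclosed.isOpen_compl, hB.isClosed,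
      hbox.image_subset, hbox.image_mem_nhdsWithin hpe hpK hbox.pos le_rfl, fun q hq => hQ hq,
      fun 𝒪' h𝒪' hsub T hT hTS H hH => ⟨H, hH.regular, hH.immersive, hH.mem_graph, hH.zero, ?_⟩⟩
    rintro q (hq | hq) w hw
    · exact hH.transverse q hq w hw
    · exact absurd ⟨w, hw.symm⟩
        (hsub (hH.mem_graph q (hbox.image_subset hq) 1 (by simp)) hq)

/-- Induction over a finite cover of `S`, starting from the constant homotopy. The graph constraint
is the intersection over all the boxes from the outset, so each step preserves what the later ones
require. -/
theorem exists_isAdmissibleHomotopy [FiniteDimensional ℝ E] [FiniteDimensional ℝ F] [T2Space W]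
    [IsManifold (𝓡 n) ∞ M] [IsManifold (𝓡 d) ∞ N] (hr : 1 ≤ r)
    (hW : IsFoliatedManifold E F r s W) {S : Set W}
    (hS : IsCompact S) (hcantor : HasCantorTransversals E F S) {f : W → M} {ι : N → M}
    (hι : IsSmoothEmbedding (𝓡 d) (𝓡 n) ∞ ι) (hclosed : IsClosed (range ι)) {U : Set W}
    (hSU : S ⊆ U) (hf : IsLeafRegularOn E F n r s f U)
    (hinj : ∀ p ∈ S, Function.Injective (leafDeriv E F n f p)) :
    ∃ H, IsAdmissibleHomotopy E F n d r s S f ι univ S H := by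
  classical
  rw [isLeafRegularOn_iff] at hf
  have hloc := fun p (hp : p ∈ S) =>
    exists_local_step hr hW hcantor hι hclosed hp (hf.2 p (hSU hp)).1
  choose! 𝒪 C h𝒪 hC hCS hCp hgraph hstep using hloc
  obtain ⟨t, htS, htC⟩ := hS.elim_nhdsWithin_subcover C hCp
  have key : ∀ u ⊆ t, ∃ H, IsAdmissibleHomotopy E F n d r s S f ι (⋂ p ∈ t, 𝒪 p)
      (⋃ p ∈ u, C p) H := by
    intro u
    induction u using Finset.induction_on with
    | empty =>
      refine fun _ => ⟨fun q => f q.1, fun p hp a _ => ?_, fun p hp a _ => hinj p hp,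
        fun p hp a _ => ?_, fun p _ => rfl, by simp [IntersectsTransversally]⟩
      · have : ∀ᶠ q in 𝓝 (p, a), q.1 ∈ U :=
          continuousAt_fst.eventually (hf.1.mem_nhds (hSU hp))
        filter_upwards [this] with q hq using (hf.2 q.1 hq).extend q.2
      · exact mem_iInter₂.2 fun q hq => hgraph q (htS q hq) p
    | insert p u hpu ih =>
      intro hu
      rw [Finset.insert_subset_iff] at hu
      obtain ⟨H, hH⟩ := ih hu.2
      rw [Finset.set_biUnion_insert, union_comm]
      exact hstep p (htS p hu.1) _
        (isOpen_biInter_finset fun q hq => h𝒪 q (htS q hq)) (biInter_subset_of_mem hu.1) _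
        (isClosed_biUnion_finset fun q hq => hC q (htS q (hu.2 hq)))
        (iUnion₂_subset fun q hq => hCS q (htS q (hu.2 hq))) H hH
  obtain ⟨H, hH⟩ := key t subset_rfl
  exact ⟨H, hH.regular, hH.immersive, fun _ _ _ _ => mem_univ _, hH.zero,
    fun p hp => hH.transverse p (htC hp)⟩

theorem IsAdmissibleHomotopy.isSolenoidHomotopy {S : Set W} {f g : W → M}
    {ι : N → M} {𝒪 : Set (W × M)} {T : Set W} {H : W × ℝ → M}
    (hH : IsAdmissibleHomotopy E F n d r s S g ι 𝒪 T H) (hg : EqOn g f S) :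
    IsSolenoidHomotopy E F n r s H f (fun p => H (p, 1)) S := by
  set U : Set (W × ℝ) := {q | ∀ᶠ q' in 𝓝 q, LeafRegularAt (E × ℝ) F n r s H q'}
  have hU : IsOpen U := isOpen_setOfPred_eventually_nhds
  refine ⟨⟨U, H, fun q hq => hH.regular q.1 hq.1 q.2 hq.2, fun _ _ => rfl,
    isLeafRegularOn_iff.2 ⟨hU, fun q hq => hq.self_of_nhds⟩⟩, fun t ht =>
    ⟨⟨(fun p => (p, t)) ⁻¹' U, _, fun p hp => hH.regular p hp t ht, fun _ _ => rfl,
      isLeafRegularOn_iff.2 ⟨hU.preimage (by fun_prop), fun q hq =>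
        LeafRegularAt.stage (Eventually.self_of_nhds hq)⟩⟩, fun p hp => hH.immersive p hp t ht⟩,
    fun p hp => (hH.zero p hp).trans (hg hp), fun _ _ => rfl⟩

end Final

end

theorem mainTheorem11 {k l n d : ℕ} {r s : ℕ∞} (hr : 1 ≤ r) (hsr : s ≤ r)
    {W : Type*} [TopologicalSpace W] [T2Space W] [SecondCountableTopology W]
    [ChartedSpace (EuclideanSpace ℝ (Fin k) × EuclideanSpace ℝ (Fin l)) W]
    (hW : IsFoliatedManifold (EuclideanSpace ℝ (Fin k)) (EuclideanSpace ℝ (Fin l)) r s W)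
    {S : Set W} (hS : IsPreSolenoid (EuclideanSpace ℝ (Fin k)) (EuclideanSpace ℝ (Fin l)) S)
    (hcantor : HasCantorTransversals (EuclideanSpace ℝ (Fin k)) (EuclideanSpace ℝ (Fin l)) S)
    {M : Type*} [TopologicalSpace M] [T2Space M] [SecondCountableTopology M]
    [ChartedSpace (EuclideanSpace ℝ (Fin n)) M] [IsManifold (𝓡 n) ∞ M]
    {f : W → M}
    (hf : IsSolenoidImmersion (EuclideanSpace ℝ (Fin k)) (EuclideanSpace ℝ (Fin l)) n r s f S)
    {N : Type*} [TopologicalSpace N] [ChartedSpace (EuclideanSpace ℝ (Fin d)) N]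
    [IsManifold (𝓡 d) ∞ N] {ι : N → M}
    (hι : IsSmoothEmbedding (𝓡 d) (𝓡 n) ∞ ι) (hclosed : IsClosed (range ι)) :
    ∃ (H : W × ℝ → M) (f₁ : W → M),
      IsSolenoidHomotopy (EuclideanSpace ℝ (Fin k)) (EuclideanSpace ℝ (Fin l)) n r s
        H f f₁ S ∧
      IntersectsTransversally (EuclideanSpace ℝ (Fin k)) (EuclideanSpace ℝ (Fin l)) n d
        f₁ S ι := by
  obtain ⟨⟨U, g, hSU, hgf, hg⟩, hinj⟩ := hf
  -- The construction runs on the regular extension `g`, since `f` itself is constrained only on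
  -- `S`.
  obtain ⟨H, hH⟩ := exists_isAdmissibleHomotopy hr hW hS.1 hcantor hι hclosed hSU hg
    fun p hp => hS.injective_leafDeriv_congr hgf hp (hinj p hp)
  exact ⟨H, _, hH.isSolenoidHomotopy hgf, hH.transverse⟩
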